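/- Let $H$ be a semisimple Hopf algebra over $\mathbb{C}$ of finite dimension $d$, with counit $\varepsilon$, and let $\Lambda\in H$ be its normalized integral, i.e. $h\Lambda=\varepsilon(h)\Lambda$ for all $h\in H$ and $\varepsilon(\Lambda)=1$. Let $H^*$ be the dual algebra (with the convolution product), let $\{\chi_0,\dots,\chi_{n-1}\}$ be the set of all irreducible characters of $H$ (listed without repetition), and let the character algebra $R(H)\subseteq H^*$ be the linear span of the $\chi_k$; it is a subalgebra of $H^*$. Let $\{F_0,\dots,F_{m-1}\}$ be the complete set of central primitive idempotents of $R(H)$ (listed without repetition) and, for each $j$, let $f_j$ be any primitive idempotent of $R(H)$ belonging to $F_j$, i.e. with $F_jf_j=f_j$. Define the normalized class sums and the generalized character table by $$\eta_j=\frac{1}{\dim(f_jH^*)}\,\bigl(\Lambda\leftharpoonup dF_j\bigr)\in H,\qquad \xi_{kj}=\langle\chi_k,\eta_j\rangle\qquad(0\le k\le n-1,\ 0\le j\le m-1),$$ where $h\leftharpoonup p=\sum\langle p,h_1\rangle h_2$ for $h\in H$, $p\in H^*$. Then the columns of $(\xi_{kj})$ are orthogonal: for all $0\le i,j\le m-1$,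 $$\sum_{k=0}^{n-1}\xi_{ki}\,\overline{\xi_{kj}}=\delta_{ij}\,\frac{d\,\dim(f_iR(H))}{\dim(f_iH^*)}.$$ -/

import Mathlib

open scoped TensorProduct

namespace HopfCharacterTable

universe u v

/-! ### Primitive idempotents -/

section Idempotents

variable {R : Type*} [Ring R]

/-- `e` is a primitive idempotent of `R`: a nonzero idempotent that is not the sum of two nonzero
orthogonal idempotents. -/
def IsPrimitiveIdempotent (e : R) : Prop :=
  IsIdempotentElem e ∧ e ≠ 0 ∧
    ∀ a b : R, IsIdempotentElem a → IsIdempotentElem b → a * b = 0 → b * a = 0 →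
      e = a + b → a = 0 ∨ b = 0

/-- `e` is a central primitive idempotent of `R`: a nonzero central idempotent that is not the sum
of two nonzero orthogonal central idempotents. -/
def IsCentralPrimitiveIdempotent (e : R) : Prop :=
  IsIdempotentElem e ∧ e ∈ Subring.center R ∧ e ≠ 0 ∧
    ∀ a b : R, IsIdempotentElem a → IsIdempotentElem b → a ∈ Subring.center R →
      b ∈ Subring.center R → a * b = 0 → e = a + b → a = 0 ∨ b = 0

/-- The dimension over `k` of the right ideal `e R` of a `k`-algebra `R`. -/
noncomputable def dimRightIdeal (k : Type*) {R : Type*} [Field k] [Ring R] [Algebra k R] (e : R) :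
    ℕ :=
  Module.finrank k (LinearMap.range (LinearMap.mulLeft k e))

end Idempotents

/-! ### Characters and the character algebra -/

section Characters

variable (k : Type v) [Field k] (H : Type u) [Ring H] [HopfAlgebra k H]

/-- The dual algebra `H^*`: all linear functionals on `H`, with the convolution product
`(p * q)(h) = ∑ p(h₁) q(h₂)` and the counit as its unit. -/
abbrev Dual : Type (max u v) := WithConv (H →ₗ[k] k)

/-- The character `h ↦ trace (h | V)` of an `H`-module `V`. -/
noncomputable def character (V : Type*) [AddCommGroup V] [Module k V] [Module H V]
    [IsScalarTower k H V] : Dual k H :=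
  WithConv.toConv (LinearMap.trace k V ∘ₗ (Algebra.lsmul k k V : H →ₐ[k] Module.End k V).toLinearMap)

/-- `χ` is the character of an irreducible finite-dimensional `H`-module. (Every simple `H`-module
is isomorphic to a quotient of `H`, so modules in the universe of `H` suffice.) -/
def IsIrreducibleCharacter (χ : Dual k H) : Prop :=
  ∃ (V : Type u) (_ : AddCommGroup V) (_ : Module k V) (_ : Module H V) (_ : IsScalarTower k H V),
    IsSimpleModule H V ∧ Module.Finite k V ∧ χ = character k H V

/-- The linear span of the irreducible characters. -/
def characterSpan : Submodule k (Dual k H) :=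
  Submodule.span k {χ | IsIrreducibleCharacter k H χ}

variable [IsSemisimpleRing H]

theorem character_mem_span_aux (n : ℕ) : ∀ (V : Type u) [AddCommGroup V] [Module k V] [Module H V]
    [IsScalarTower k H V] [Module.Finite k V], Module.finrank k V = n →
    character k H V ∈ characterSpan k H := by
  induction n using Nat.strong_induction_on with
  | _ n ih =>
    intro V _ _ _ _ _ hn
    rcases subsingleton_or_nontrivial V with hV | hV
    · have : character k H V = 0 := by
        ext h
        have h0 : (Algebra.lsmul k k V : H →ₐ[k] Module.End k V) h = 0 := Subsingleton.elim _ _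
        simp [character, h0]
      rw [this]
      exact zero_mem _
    · obtain ⟨S, hS⟩ := IsSemisimpleModule.exists_simple_submodule H V
      obtain ⟨T, hT⟩ := exists_isCompl S
      let e : (S × T) ≃ₗ[k] V := (Submodule.prodEquivOfIsCompl S T hT).restrictScalars k
      have : Module.Finite k (S × T) := Module.Finite.equiv e.symm
      have : Module.Finite k S := Module.Finite.of_surjective (LinearMap.fst k S T)
        LinearMap.fst_surjective
      have : Module.Finite k T := Module.Finite.of_surjective (LinearMap.snd k S T)
        LinearMap.snd_surjective
      have hchar : character k H V = character k H S + character k H T := by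
        ext h
        have h1 : (Algebra.lsmul k k V : H →ₐ[k] Module.End k V) h = e.conj
            (((Algebra.lsmul k k S : H →ₐ[k] Module.End k S) h).prodMap
              ((Algebra.lsmul k k T : H →ₐ[k] Module.End k T) h)) := by
          ext x
          obtain ⟨y, rfl⟩ := e.surjective x
          simp only [LinearEquiv.conj_apply_apply, LinearEquiv.symm_apply_apply,
            LinearMap.prodMap_apply, Algebra.lsmul_coe]
          exact ((Submodule.prodEquivOfIsCompl S T hT).map_smul h y).symm
        change LinearMap.trace k V _ = LinearMap.trace k S _ + LinearMap.trace k T _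
        simp only [AlgHom.toLinearMap_apply]
        rw [h1, LinearMap.trace_conj', LinearMap.trace_prodMap']
      have hfr : Module.finrank k V = Module.finrank k S + Module.finrank k T := by
        rw [← e.finrank_eq, Module.finrank_prod]
      have := IsSimpleModule.nontrivial H S
      have hpos : 0 < Module.finrank k S := Module.finrank_pos
      rw [hchar]
      exact add_mem (Submodule.subset_span ⟨S, _, _, _, inferInstance, hS, inferInstance, rfl⟩)
        (ih _ (by omega) T rfl)

theorem trace_mem_span (U : Type u) [AddCommGroup U] [Module k U] [Module.Finite k U]
    (ρ : H →ₐ[k] Module.End k U) :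
    WithConv.toConv (LinearMap.trace k U ∘ₗ ρ.toLinearMap) ∈ characterSpan k H := by
  let : Module H U := Module.compHom U ρ.toRingHom
  have : IsScalarTower k H U := ⟨fun a h x => by
    change ρ (a • h) x = a • ρ h x
    simp⟩
  exact character_mem_span_aux k H _ U rfl

theorem character_mul_mem_span {χ ψ : Dual k H} (hχ : IsIrreducibleCharacter k H χ)
    (hψ : IsIrreducibleCharacter k H ψ) : χ * ψ ∈ characterSpan k H := by
  obtain ⟨V, _, _, _, _, -, _, rfl⟩ := hχ
  obtain ⟨W, _, _, _, _, -, _, rfl⟩ := hψ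
  let ρ : H →ₐ[k] Module.End k (V ⊗[k] W) :=
    ((Module.endTensorEndAlgHom (R := k) (A := k) (M := V) (N := W)).comp
      (Algebra.TensorProduct.map (Algebra.lsmul k k V) (Algebra.lsmul k k W))).comp
      (Bialgebra.comulAlgHom k H)
  have key : character k H V * character k H W
      = WithConv.toConv (LinearMap.trace k (V ⊗[k] W) ∘ₗ ρ.toLinearMap) := by
    ext h
    have : LinearMap.mul' k k ∘ₗ TensorProduct.map (character k H V).ofConv
        (character k H W).ofConv = LinearMap.trace k (V ⊗[k] W) ∘ₗ
        ((Module.endTensorEndAlgHom (R := k) (A := k) (M := V) (N := W)).comp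
      (Algebra.TensorProduct.map (Algebra.lsmul k k V : H →ₐ[k] Module.End k V)
        (Algebra.lsmul k k W : H →ₐ[k] Module.End k W))).toLinearMap := by
      ext a b
      simp only [character, TensorProduct.AlgebraTensorModule.curry_apply,
        LinearMap.restrictScalars_self, TensorProduct.curry_apply, LinearMap.comp_apply,
        TensorProduct.map_tmul, LinearMap.mul'_apply, AlgHom.toLinearMap_apply, AlgHom.comp_apply,
        Algebra.TensorProduct.map_tmul, Module.endTensorEndAlgHom_apply]
      exact (LinearMap.trace_tensorProduct' _ _).symm
    exact LinearMap.congr_fun this (Coalgebra.comul h)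
  rw [key]
  exact trace_mem_span k H _ ρ

theorem one_mem_characterSpan : (1 : Dual k H) ∈ characterSpan k H := by
  let U : Submodule k H := Submodule.span k {(1 : H)}
  have hH : (1 : H) ≠ 0 := fun h => by
    have h1 : Coalgebra.counit (R := k) (1 : H) = 1 := Bialgebra.counit_one
    rw [h, map_zero] at h1
    exact zero_ne_one h1
  have hU : Module.finrank k U = 1 := finrank_span_singleton hH
  let ρ : H →ₐ[k] Module.End k U := (Algebra.ofId k _).comp (Bialgebra.counitAlgHom k H)
  have key : (1 : Dual k H) = WithConv.toConv (LinearMap.trace k U ∘ₗ ρ.toLinearMap) := by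
    ext h
    simp [ρ, Algebra.ofId_apply, Algebra.algebraMap_eq_smul_one, hU]
  rw [key]
  exact trace_mem_span k H U ρ

theorem mul_mem_characterSpan (x y : Dual k H) (hx : x ∈ characterSpan k H)
    (hy : y ∈ characterSpan k H) : x * y ∈ characterSpan k H := by
  refine Submodule.span_induction₂ (p := fun a b _ _ => a * b ∈ characterSpan k H)
    (fun a b ha hb => character_mul_mem_span k H ha hb) ?_ ?_ ?_ ?_ ?_ ?_ hx hy
  · intro a _; simp
  · intro a _; simp
  · intro a b c _ _ _ h1 h2; rw [add_mul]; exact add_mem h1 h2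
  · intro a b c _ _ _ h1 h2; rw [mul_add]; exact add_mem h1 h2
  · intro r a b _ _ h; rw [smul_mul_assoc]; exact Submodule.smul_mem _ r h
  · intro r a b _ _ h; rw [mul_smul_comm]; exact Submodule.smul_mem _ r h

/-- The character algebra `R(H)`: the linear span of the irreducible characters of `H`, as a
subalgebra of `H^*`. -/
noncomputable def characterAlgebra : Subalgebra k (Dual k H) :=
  (characterSpan k H).toSubalgebra (one_mem_characterSpan k H) (mul_mem_characterSpan k H)

end Characters

/-! ### Class sums and the generalized character table -/

section Table

variable {k : Type v} [Field k] {H : Type u} [Ring H] [HopfAlgebra k H]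

/-- `Λ` is the normalized left integral of `H`: `h Λ = ε(h) Λ` for all `h`, and `ε(Λ) = 1`. -/
def IsNormalizedIntegral (k : Type v) [Field k] {H : Type u} [Ring H] [HopfAlgebra k H]
    (Λ : H) : Prop :=
  (∀ h : H, h * Λ = Coalgebra.counit (R := k) h • Λ) ∧ Coalgebra.counit (R := k) Λ = 1

/-- The right hit action `h ↼ p = ∑ p(h₁) h₂` of `H^*` on `H`. -/
noncomputable def rightHit (h : H) (p : Dual k H) : H :=
  TensorProduct.lid k H (LinearMap.rTensor H p.ofConv (Coalgebra.comul h))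

/-- The hit action is characterized by `⟨q, h ↼ p⟩ = ⟨p q, h⟩`. -/
theorem apply_rightHit (h : H) (p q : Dual k H) : q (rightHit h p) = (p * q) h := by
  rw [rightHit, LinearMap.convMul_apply]
  generalize Coalgebra.comul (R := k) h = t
  induction t with
  | zero => simp
  | tmul a b => simp
  | add a b ha hb => simp only [map_add, ha, hb]

variable [IsSemisimpleRing H]

/-- The class sum `Λ ↼ (d F)` of `F ∈ R(H)`, where `d = dim H`. -/
noncomputable def classSum (Λ : H) (F : characterAlgebra k H) : H :=
  rightHit Λ ((Module.finrank k H : k) • (F : Dual k H))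

/-- The normalized class sum `(1 / dim (f H^*)) (Λ ↼ (d F))`, for a primitive idempotent `f` of
`R(H)` belonging to the central primitive idempotent `F`. -/
noncomputable def normalizedClassSum (Λ : H) (F f : characterAlgebra k H) : H :=
  (dimRightIdeal k (f : Dual k H) : k)⁻¹ • classSum Λ F

/-- The generalized character table `ξ_{ij} = ⟨χ_i, η_j⟩`. -/
noncomputable def characterTable (Λ : H) {n m : ℕ} (χ : Fin n → Dual k H)
    (F f : Fin m → characterAlgebra k H) (i : Fin n) (j : Fin m) : k :=
  χ i (normalizedClassSum Λ (F j) (f j))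

end Table

end HopfCharacterTable

/-!
Write `τ(p) = p(Λ)` for the evaluation of functionals at the integral, and `d = dim H`. Up to the
factor `d / dim (f_j H^*)` the entry `ξ_{kj}` is `τ(F_j χ_k)`, so the columns of the table are, up
to scalars and complex conjugation, the coordinate vectors of the `F_j` in a basis of `R(H)` that
is orthonormal for a positive definite hermitian form.

*The trace.* By a theorem of Larson and Radford the antipode of `H` is an involution
(`antipodeSq_eq_one`), and then `d τ` is the trace of the regular representation of `H^*`
(`trace_mulLeft_dual`). Therefore `τ` is symmetric and vanishes on nilpotent elements, and
`dim (f H^*) = d τ(f)` for every idempotent `f` of `H^*`.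

*The antipode.* The functional `λ(h) = Tr(x ↦ h S²(x))` is an integral of `H^*` with `λ(Λ) = 1`,
and it yields a Radford formula `a S⁴(y) = y a` with `a` group-like, so that `S²` has finite order.
Moreover `Tr(S²) ≠ 0`: since `S²` fixes the center of `H` pointwise it acts on each matrix block by
an inner automorphism `x ↦ t x t⁻¹`, with trace `Tr(t) Tr(t⁻¹) ≥ 0`, and if all these numbers
vanished then so would `λ`. The regular character divided by `d` is an idempotent of `H^*`, and the
trace formula `trace_antipodeSq_comp_hitMap` applied to it shows that `Tr(S²) / d` is an algebraic
integer. All its conjugates have absolute value at most one (`le_norm_sum_of_dvd`), so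
`|Tr(S²)| = d`; as `S²` fixes `1`, it is the identity.

*Positivity.* The characters satisfy `τ(χ_i (χ_j ∘ S)) = δ_{ij}`, by Schur's lemma and averaging
over `Λ`. The conjugate-linear map `†` with `χ_i† = χ_i ∘ S` is an involutive antiautomorphism of
`R(H)`, because the structure constants are natural numbers, and `τ(p q†)` is a positive definite
form with orthonormal basis `χ_k`. In particular `F F† ≠ 0`, which forces `F_j† = F_j`
(`IsCentralPrimitiveIdempotent.dagger_eq`). Parseval's identity now gives
`∑_k τ(F_i χ_k) conj τ(F_j χ_k) = τ(F_i F_j)`, and this is `δ_{ij} τ(F_i)`.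

*Dimensions.* Finally `τ(F_i) = dim (f_i R(H)) τ(f_i)` (`dimRightIdeal_mul_trace`): in the
symmetric algebra `R(H)` the Casimir element `∑_k (χ_k ∘ S) f_i χ_k` is a multiple `s F_i`, and the
traces of `x ↦ f_i x` and of `x ↦ f_i x f_i`, which are `dim (f_i R(H))` and `1`, equal `s τ(F_i)`
and `s τ(f_i)`.
-/

namespace HopfCharacterTable

open Coalgebra HopfAlgebra WithConv
open scoped TensorProduct

universe u v

/-! ### The hit action on `H` and functionals on `H ⊗ H` -/

section Hit
variable {k : Type v} [Field k] {H : Type u} [Ring H] [HopfAlgebra k H]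

theorem eq_of_forall_dual_apply_eq {x y : H} (h : ∀ q : Dual k H, q x = q y) : x = y :=
  Module.forall_dual_apply_eq_zero_iff k (x - y) |>.1 (fun q => by
    have := h (toConv q)
    simpa [sub_eq_zero] using this) |> sub_eq_zero.1

/-- The operator `h ↦ ∑ p(h₁) h₂` on `H`; it is the transpose of left multiplication by `p` on the
dual algebra. -/
def hitMap (p : Dual k H) : H →ₗ[k] H :=
  (TensorProduct.lid k H).toLinearMap ∘ₗ LinearMap.rTensor H p.ofConv ∘ₗ comul

theorem apply_hitMap (p q : Dual k H) (h : H) : q (hitMap p h) = (p * q) h :=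
  apply_rightHit h p q

theorem hitMap_comp_hitMap (p q : Dual k H) : hitMap p ∘ₗ hitMap q = hitMap (q * p) := by
  ext h
  refine eq_of_forall_dual_apply_eq (k := k) fun r => ?_
  rw [LinearMap.comp_apply, apply_hitMap, apply_hitMap, apply_hitMap, mul_assoc]

/-- The functional `p ⊗ q` on `H ⊗ H`. -/
def pairing (p q : Dual k H) : H ⊗[k] H →ₗ[k] k :=
  LinearMap.mul' k k ∘ₗ TensorProduct.map p.ofConv q.ofConv

@[simp] theorem pairing_tmul (p q : Dual k H) (x y : H) : pairing p q (x ⊗ₜ y) = p x * q y := rfl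

theorem mul_apply_eq_pairing (p q : Dual k H) (h : H) : (p * q) h = pairing p q (comul h) := rfl

/-- The functional `x ↦ p(s x)`. -/
def translateLeft (s : H) (p : Dual k H) : Dual k H := toConv (p.ofConv ∘ₗ LinearMap.mulLeft k s)

/-- The functional `x ↦ p(x s)`. -/
def translateRight (s : H) (p : Dual k H) : Dual k H := toConv (p.ofConv ∘ₗ LinearMap.mulRight k s)

@[simp] theorem translateLeft_apply (s : H) (p : Dual k H) (x : H) :
    translateLeft s p x = p (s * x) := rfl

@[simp] theorem translateRight_apply (s : H) (p : Dual k H) (x : H) :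
    translateRight s p x = p (x * s) := rfl

/-- The functional `x ↦ p(S x)`. -/
def antipodeDual (p : Dual k H) : Dual k H := toConv (p.ofConv ∘ₗ antipode k)

@[simp] theorem antipodeDual_apply (p : Dual k H) (x : H) :
    antipodeDual p x = p (antipode k x) := rfl

theorem pairing_translate (p q : Dual k H) (a b c d : H) (t : H ⊗[k] H) :
    pairing (translateLeft a (translateRight b p)) (translateLeft c (translateRight d q)) t =
      pairing p q ((a ⊗ₜ c) * t * (b ⊗ₜ d)) := by
  induction t with
  | zero => simp
  | tmul x y => simp
  | add x y hx hy => simp only [map_add, hx, hy, mul_add, add_mul]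

@[simp] theorem translateLeft_one (p : Dual k H) : translateLeft 1 p = p := by
  ext x; change p (1 * x) = p x; rw [one_mul]

@[simp] theorem translateRight_one (p : Dual k H) : translateRight 1 p = p := by
  ext x; change p (x * 1) = p x; rw [mul_one]

theorem eq_of_forall_pairing_eq [FiniteDimensional k H] {s t : H ⊗[k] H}
    (h : ∀ p q : Dual k H, pairing p q s = pairing p q t) : s = t := by
  let b := Module.finBasis k H
  refine (b.tensorProduct b).ext_elem fun ij => ?_
  have key : ∀ w : H ⊗[k] H, (b.tensorProduct b).repr w ij =
      pairing (toConv (b.coord ij.1)) (toConv (b.coord ij.2)) w := by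
    intro w
    induction w with
    | zero => simp
    | tmul x y =>
      obtain ⟨i, j⟩ := ij
      rw [Module.Basis.tensorProduct_repr_tmul_apply, pairing_tmul, smul_eq_mul, mul_comm]
      rfl
    | add x y hx hy => simp only [map_add, Finsupp.add_apply, hx, hy]
  rw [key, key, h]

end Hit

/-! ### Sweedler identities for the antipode -/

section Convolution
variable {k : Type v} [Field k] {H : Type u} [Ring H] [HopfAlgebra k H]
variable {B : Type*} [Ring B] [Algebra k B]

theorem algHom_conv_mul_antipode (φ : H →ₐ[k] B) :
    toConv φ.toLinearMap * toConv (φ.toLinearMap ∘ₗ antipode k) = 1 := by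
  have h := LinearMap.algHom_comp_convMul_distrib (R := k) φ (toConv LinearMap.id)
    (toConv (antipode k (A := H)))
  rw [LinearMap.id_mul_antipode] at h
  apply ofConv_injective
  simp only [LinearMap.comp_id] at h
  rw [← h]
  ext x
  simp [LinearMap.convOne_def]

theorem algHom_antipode_conv_mul (φ : H →ₐ[k] B) :
    toConv (φ.toLinearMap ∘ₗ antipode k) * toConv φ.toLinearMap = 1 := by
  have h := LinearMap.algHom_comp_convMul_distrib (R := k) φ
    (toConv (antipode k (A := H))) (toConv LinearMap.id)
  rw [LinearMap.antipode_mul_id] at h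
  apply ofConv_injective
  simp only [LinearMap.comp_id] at h
  rw [← h]
  ext x
  simp [LinearMap.convOne_def]

variable (k H)

/-- The comultiplication, as an element of the convolution algebra of linear maps `H → H ⊗ H`. -/
def convComul : WithConv (H →ₗ[k] H ⊗[k] H) := toConv (Bialgebra.comulAlgHom k H).toLinearMap

/-- The map `x ↦ x ⊗ 1` in the convolution algebra. -/
def convLeft : WithConv (H →ₗ[k] H ⊗[k] H) :=
  toConv (Algebra.TensorProduct.includeLeft : H →ₐ[k] H ⊗[k] H).toLinearMap

/-- The map `x ↦ 1 ⊗ x` in the convolution algebra. -/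
def convRight : WithConv (H →ₗ[k] H ⊗[k] H) :=
  toConv (Algebra.TensorProduct.includeRight : H →ₐ[k] H ⊗[k] H).toLinearMap

/-- The convolution inverse `x ↦ S x ⊗ 1` of `convLeft`. -/
def convLeftInv : WithConv (H →ₗ[k] H ⊗[k] H) :=
  toConv ((Algebra.TensorProduct.includeLeft : H →ₐ[k] H ⊗[k] H).toLinearMap ∘ₗ antipode k)

/-- The convolution inverse `x ↦ 1 ⊗ S x` of `convRight`. -/
def convRightInv : WithConv (H →ₗ[k] H ⊗[k] H) :=
  toConv ((Algebra.TensorProduct.includeRight : H →ₐ[k] H ⊗[k] H).toLinearMap ∘ₗ antipode k)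

/-- The convolution inverse `x ↦ Δ(S x)` of `convComul`. -/
def convComulInv : WithConv (H →ₗ[k] H ⊗[k] H) :=
  toConv ((Bialgebra.comulAlgHom k H).toLinearMap ∘ₗ antipode k)

theorem convLeft_mul_convRight : convLeft k H * convRight k H = convComul k H := by
  ext x
  rw [(ℛ k x).convMul_apply]
  change ∑ i ∈ _, ((ℛ k x).left i ⊗ₜ[k] (1 : H)) * ((1 : H) ⊗ₜ[k] (ℛ k x).right i) = comul x
  simp only [Algebra.TensorProduct.tmul_mul_tmul, mul_one, one_mul]
  exact (ℛ k x).eq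

theorem convLeft_mul_inv : convLeft k H * convLeftInv k H = 1 := algHom_conv_mul_antipode _
theorem convLeft_inv_mul : convLeftInv k H * convLeft k H = 1 := algHom_antipode_conv_mul _
theorem convRight_mul_inv : convRight k H * convRightInv k H = 1 := algHom_conv_mul_antipode _
theorem convComul_inv_mul : convComulInv k H * convComul k H = 1 := algHom_antipode_conv_mul _

theorem convComulInv_eq : convComulInv k H = convRightInv k H * convLeftInv k H := by
  refine left_inv_eq_right_inv (convComul_inv_mul k H) ?_
  rw [← convLeft_mul_convRight, mul_assoc, ← mul_assoc (convRight k H), convRight_mul_inv, one_mul,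
    convLeft_mul_inv]

theorem convComul_mul_convRightInv : convComul k H * convRightInv k H = convLeft k H := by
  rw [← convLeft_mul_convRight, mul_assoc, convRight_mul_inv, mul_one]

theorem convLeftInv_mul_convComul : convLeftInv k H * convComul k H = convRight k H := by
  rw [← convLeft_mul_convRight, ← mul_assoc, convLeft_inv_mul, one_mul]

theorem convComulInv_mul_convLeft : convComulInv k H * convLeft k H = convRightInv k H := by
  rw [convComulInv_eq, mul_assoc, convLeft_inv_mul, mul_one]

variable {k H}

/-- The antipode is an antihomomorphism of coalgebras. -/
theorem comul_antipode {x : H} {ι : Type*} (r : Coalgebra.Repr k x ι) :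
    comul (R := k) (antipode k x) =
      ∑ i ∈ r.index, antipode k (r.right i) ⊗ₜ[k] antipode k (r.left i) := by
  have h := congrArg (fun f : WithConv (H →ₗ[k] H ⊗[k] H) => f x) (convComulInv_eq k H)
  simp only [r.convMul_apply] at h
  refine h.trans (Finset.sum_congr rfl fun i _ => ?_)
  change ((1 : H) ⊗ₜ[k] antipode k (r.left i)) * (antipode k (r.right i) ⊗ₜ[k] (1 : H)) = _
  simp

theorem sum_comul_antipode_mul {x : H} {ι : Type*} (r : Coalgebra.Repr k x ι) :
    ∑ i ∈ r.index, comul (R := k) (antipode k (r.left i)) * (r.right i ⊗ₜ[k] (1 : H)) =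
      (1 : H) ⊗ₜ[k] antipode k x := by
  have h := congrArg (fun f : WithConv (H →ₗ[k] H ⊗[k] H) => f x) (convComulInv_mul_convLeft k H)
  simp only [r.convMul_apply] at h
  exact h

theorem sum_antipode_tmul_mul_comul {x : H} {ι : Type*} (r : Coalgebra.Repr k x ι) :
    ∑ i ∈ r.index, (antipode k (r.left i) ⊗ₜ[k] (1 : H)) * comul (R := k) (r.right i) =
      (1 : H) ⊗ₜ[k] x := by
  have h := congrArg (fun f : WithConv (H →ₗ[k] H ⊗[k] H) => f x) (convLeftInv_mul_convComul k H)
  simp only [r.convMul_apply] at h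
  exact h

theorem sum_comul_mul_tmul_antipode {x : H} {ι : Type*} (r : Coalgebra.Repr k x ι) :
    ∑ i ∈ r.index, comul (R := k) (r.left i) * ((1 : H) ⊗ₜ[k] antipode k (r.right i)) =
      x ⊗ₜ[k] (1 : H) := by
  have h := congrArg (fun f : WithConv (H →ₗ[k] H ⊗[k] H) => f x) (convComul_mul_convRightInv k H)
  simp only [r.convMul_apply] at h
  exact h

/-- In Sweedler notation `∑ Δ(S²(x₂)) (S(x₁) ⊗ 1) = 1 ⊗ S²(x)`. -/
theorem sum_comul_antipode_antipode_mul {x : H} {ι : Type*} (r : Coalgebra.Repr k x ι) :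
    ∑ i ∈ r.index, comul (R := k) (antipode k (antipode k (r.right i))) *
      (antipode k (r.left i) ⊗ₜ[k] (1 : H)) = (1 : H) ⊗ₜ[k] antipode k (antipode k x) := by
  let s : Coalgebra.Repr k (antipode k x) ι :=
    { index := r.index
      left := fun i => antipode k (r.right i)
      right := fun i => antipode k (r.left i)
      eq := (comul_antipode r).symm }
  exact sum_comul_antipode_mul s

end Convolution

/-! ### Integrals of `H` and of its dual -/

section Integrals
variable {k : Type v} [Field k] {H : Type u} [Ring H] [HopfAlgebra k H]

/-- Evaluation of functionals at `x`. -/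
def evalAt (x : H) : Dual k H →ₗ[k] k :=
  { toFun := fun p => p x
    map_add' := fun _ _ => rfl
    map_smul' := fun _ _ => rfl }

theorem dual_sum_apply {ι : Type*} (s : Finset ι) (f : ι → Dual k H) (x : H) :
    (∑ i ∈ s, f i) x = ∑ i ∈ s, f i x := map_sum (evalAt x) f s

theorem dual_map_sum {ι : Type*} (s : Finset ι) (p : Dual k H) (f : ι → H) :
    p (∑ i ∈ s, f i) = ∑ i ∈ s, p (f i) := map_sum p.ofConv f s

theorem dual_map_smul (p : Dual k H) (c : k) (x : H) : p (c • x) = c * p x := map_smul p.ofConv c x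

theorem dual_smul_apply (p : Dual k H) (c : k) (x : H) : (c • p) x = c * p x := rfl

theorem dual_one_apply (x : H) : (1 : Dual k H) x = counit x := rfl

/-- `μ` is a left integral of the dual algebra: `p * μ = p(1) μ` for every functional `p`. -/
def IsLeftDualIntegral (μ : Dual k H) : Prop := ∀ p : Dual k H, p * μ = p 1 • μ

variable (k H) in
/-- The square of the antipode, as an endomorphism of the algebra `H`. -/
noncomputable def antipodeSq : H →ₐ[k] H :=
  AlgHom.ofLinearMap (antipode k ∘ₗ antipode k) (by simp) (fun x y => by
    simp [antipode_mul_antidistrib])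

@[simp] theorem antipodeSq_apply (x : H) : antipodeSq k H x = antipode k (antipode k x) := rfl

variable (k H) in
/-- The functional `h ↦ Tr(x ↦ h S²(x))` on `H`. -/
noncomputable def traceIntegral : Dual k H :=
  toConv (LinearMap.trace k H ∘ₗ LinearMap.lcomp k H (antipodeSq k H).toLinearMap ∘ₗ
    LinearMap.mul k H)

theorem traceIntegral_apply (h : H) : traceIntegral k H h =
    LinearMap.trace k H (LinearMap.mulLeft k h ∘ₗ (antipodeSq k H).toLinearMap) := rfl

/-- With `b_j` a basis of `H` and `b^j` its dual basis, `∑_j p(y₁ b_j) b^j(S(y₂)) = p(y₁ S(y₂))`,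
which is `p(1) ε(y)`. -/
theorem sum_translateRight_mul_antipodeDual [FiniteDimensional k H] (p : Dual k H) :
    ∑ j, translateRight (Module.finBasis k H j) p *
      antipodeDual (toConv ((Module.finBasis k H).coord j)) = p 1 • 1 := by
  let b := Module.finBasis k H
  ext y
  have h2 : ∑ i ∈ (ℛ k y).index, (ℛ k y).left i * antipode k ((ℛ k y).right i) = _ :=
    sum_mul_antipode_eq_smul (ℛ k y)
  have h4 : ∀ x z : H, p (x * z) = ∑ j, p (x * b j) * b.coord j z := by
    intro x z
    conv_lhs => rw [← b.sum_repr z]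
    simp only [Finset.mul_sum, dual_map_sum, mul_smul_comm, dual_map_smul,
      Module.Basis.coord_apply]
    exact Finset.sum_congr rfl fun _ _ => mul_comm _ _
  have h3 := congrArg p.ofConv h2
  change p _ = p _ at h3
  rw [dual_map_sum, dual_map_smul] at h3
  simp only [h4 _ (antipode k _)] at h3
  rw [Finset.sum_comm] at h3
  rw [dual_sum_apply]
  simp only [(ℛ k y).convMul_apply]
  refine h3.trans ?_
  rw [dual_smul_apply, mul_comm]
  rfl

theorem pairing_translateRight_left (p q : Dual k H) (s : H) (t : H ⊗[k] H) :
    pairing (translateRight s p) q t = pairing p q (t * (s ⊗ₜ 1)) := by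
  have := pairing_translate p q 1 s 1 1 t
  simp only [translateLeft_one, translateRight_one, ← Algebra.TensorProduct.one_def, one_mul] at this
  exact this

theorem pairing_translateLeft_left (p q : Dual k H) (s : H) (t : H ⊗[k] H) :
    pairing (translateLeft s p) q t = pairing p q ((s ⊗ₜ 1) * t) := by
  have := pairing_translate p q s 1 1 1 t
  simp only [translateLeft_one, translateRight_one, ← Algebra.TensorProduct.one_def, mul_one] at this
  exact this

theorem pairing_translateLeft_right (p q : Dual k H) (s : H) (t : H ⊗[k] H) :
    pairing p (translateLeft s q) t = pairing p q ((1 ⊗ₜ s) * t) := by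
  have := pairing_translate p q 1 1 s 1 t
  simp only [translateLeft_one, translateRight_one, ← Algebra.TensorProduct.one_def, mul_one] at this
  exact this

theorem pairing_translateRight_right (p q : Dual k H) (s : H) (t : H ⊗[k] H) :
    pairing p (translateRight s q) t = pairing p q (t * (1 ⊗ₜ s)) := by
  have := pairing_translate p q 1 1 1 s t
  simp only [translateLeft_one, translateRight_one, ← Algebra.TensorProduct.one_def, one_mul] at this
  exact this

/-- In a semisimple Hopf algebra left integrals are right integrals. -/
theorem IsNormalizedIntegral.mul_right [IsSemisimpleRing H] {Λ : H}
    (hΛ : IsNormalizedIntegral k Λ) (h : H) : Λ * h = counit (R := k) h • Λ := by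
  obtain ⟨hΛ1, hΛ2⟩ := hΛ
  set z : H := Λ * h - counit (R := k) h • Λ with hz
  have hz1 : ∀ x, x * z = counit (R := k) x • z := fun x => by
    rw [hz, mul_sub, ← mul_assoc, hΛ1, mul_smul_comm, hΛ1, smul_sub, smul_mul_assoc, smul_comm]
  have hz0 : counit (R := k) z = 0 := by
    simp [hz, hΛ2]
  obtain ⟨e, he, hs⟩ := IsSemisimpleRing.ideal_eq_span_idempotent (Ideal.span {z})
  have he1 : e ∈ Ideal.span {z} := hs ▸ Ideal.mem_span_singleton_self e
  obtain ⟨c, hc⟩ := Ideal.mem_span_singleton'.1 he1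
  have he0 : e = 0 := by
    rw [← he.eq, ← hc, mul_assoc, ← mul_assoc z, hz1, Bialgebra.counit_mul, hz0, zero_mul, zero_smul,
      mul_zero]
  have hz2 : z ∈ Ideal.span {e} := hs ▸ Ideal.mem_span_singleton_self z
  rw [he0, Ideal.mem_span_singleton'] at hz2
  obtain ⟨a, ha⟩ := hz2
  rw [mul_zero] at ha
  exact sub_eq_zero.1 ha.symm

variable [FiniteDimensional k H]

/-- With `b_j` a basis of `H` and `b^j` its dual basis, the operator `x ↦ ∑ p(h₁) h₂ S²(x)` equals
`∑_j P_j ∘ (x ↦ h S²(x)) ∘ Q_j` where `∑_j Q_j ∘ P_j = p(1)`. Taking traces gives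
`(p * λ)(h) = p(1) λ(h)`. -/
theorem isLeftDualIntegral_traceIntegral : IsLeftDualIntegral (traceIntegral k H) := by
  intro p
  ext h
  let b := Module.finBasis k H
  let A := (antipodeSq k H).toLinearMap
  let T := LinearMap.mulLeft k h ∘ₗ A
  let P := fun j => hitMap (translateRight (b j) p)
  let Q := fun j => hitMap (antipodeDual (toConv (b.coord j)))
  have hQP : ∑ j, Q j ∘ₗ P j = p 1 • LinearMap.id := by
    ext y
    refine eq_of_forall_dual_apply_eq (k := k) fun r => ?_
    rw [LinearMap.sum_apply, dual_map_sum, LinearMap.smul_apply, dual_map_smul]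
    simp only [P, Q, hitMap_comp_hitMap, apply_hitMap]
    rw [← dual_sum_apply, ← Finset.sum_mul, sum_translateRight_mul_antipodeDual, smul_mul_assoc,
      one_mul]
    rfl
  have hO : ∑ i ∈ (ℛ k h).index, p ((ℛ k h).left i) • (LinearMap.mulLeft k ((ℛ k h).right i) ∘ₗ A) =
      ∑ j, P j ∘ₗ T ∘ₗ Q j := by
    ext x
    refine eq_of_forall_dual_apply_eq (k := k) fun q => ?_
    rw [LinearMap.sum_apply, LinearMap.sum_apply, dual_map_sum, dual_map_sum]
    have hl : ∑ i ∈ (ℛ k h).index, q ((p ((ℛ k h).left i) •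
        (LinearMap.mulLeft k ((ℛ k h).right i) ∘ₗ A)) x) =
        pairing p q (comul h * (1 ⊗ₜ A x)) := by
      rw [← (ℛ k h).eq, Finset.sum_mul, map_sum]
      refine Finset.sum_congr rfl fun i _ => ?_
      rw [Algebra.TensorProduct.tmul_mul_tmul, mul_one, pairing_tmul]
      exact dual_map_smul _ _ _
    have hr : ∀ j, q ((P j ∘ₗ T ∘ₗ Q j) x) = ∑ i ∈ (ℛ k x).index,
        b.coord j (antipode k ((ℛ k x).left i)) *
          pairing p q (comul (h * A ((ℛ k x).right i)) * (b j ⊗ₜ 1)) := by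
      intro j
      let φ : H →ₗ[k] k := q.ofConv ∘ₗ P j ∘ₗ T
      have h1 : q ((P j ∘ₗ T ∘ₗ Q j) x) =
          (toConv φ : Dual k H) (Q j x) := rfl
      rw [h1, apply_hitMap, (ℛ k x).convMul_apply]
      refine Finset.sum_congr rfl fun i _ => ?_
      congr 1
      rw [← pairing_translateRight_left, ← mul_apply_eq_pairing, ← apply_hitMap]
      rfl
    rw [hl]
    simp only [hr]
    rw [Finset.sum_comm]
    have h2 := congrArg (fun t => pairing p q (comul h * t))
      (sum_comul_antipode_antipode_mul (ℛ k x))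
    simp only [Finset.mul_sum, map_sum] at h2
    refine h2.symm.trans (Finset.sum_congr rfl fun i _ => ?_)
    rw [← mul_assoc, ← Bialgebra.comul_mul]
    conv_lhs => rw [← b.sum_repr (antipode k ((ℛ k x).left i))]
    rw [TensorProduct.sum_tmul, Finset.mul_sum, map_sum]
    refine Finset.sum_congr rfl fun j _ => ?_
    rw [← TensorProduct.smul_tmul', mul_smul_comm, map_smul, smul_eq_mul]
    rfl
  have h1 : (p * traceIntegral k H) h = LinearMap.trace k H (∑ i ∈ (ℛ k h).index,
      p ((ℛ k h).left i) • (LinearMap.mulLeft k ((ℛ k h).right i) ∘ₗ A)) := by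
    rw [(ℛ k h).convMul_apply, map_sum]
    simp only [map_smul]
    rfl
  rw [h1, hO, map_sum]
  have h2 : ∀ j, LinearMap.trace k H (P j ∘ₗ T ∘ₗ Q j) = LinearMap.trace k H (T ∘ₗ (Q j ∘ₗ P j)) := by
    intro j
    rw [LinearMap.trace_comp_comm', LinearMap.comp_assoc]
  have h3 : ∑ j, T ∘ₗ (Q j ∘ₗ P j) = T ∘ₗ ∑ j, Q j ∘ₗ P j :=
    (Finset.mul_sum (R := Module.End k H) _ _ _).symm
  simp only [h2]
  rw [← map_sum, h3, hQP, LinearMap.comp_smul, map_smul]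
  rfl

theorem traceIntegral_integral [IsSemisimpleRing H] {Λ : H} (hΛ : IsNormalizedIntegral k Λ) :
    traceIntegral k H Λ = 1 := by
  have h1 : LinearMap.mulLeft k Λ ∘ₗ (antipodeSq k H).toLinearMap =
      (counit : H →ₗ[k] k).smulRight Λ := by
    ext x
    simp [hΛ.mul_right]
  rw [traceIntegral_apply, h1, LinearMap.trace_smulRight, hΛ.2]

/-- The trace integral is a trace up to the twist by `S²`. -/
theorem traceIntegral_mul_comm (x y : H) :
    traceIntegral k H (x * y) = traceIntegral k H (y * antipodeSq k H x) := by
  rw [traceIntegral_apply, traceIntegral_apply]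
  have h1 : LinearMap.mulLeft k (x * y) ∘ₗ (antipodeSq k H).toLinearMap =
      LinearMap.mulLeft k x ∘ₗ (LinearMap.mulLeft k y ∘ₗ (antipodeSq k H).toLinearMap) := by
    ext z; simp
  have h2 : LinearMap.mulLeft k (y * antipodeSq k H x) ∘ₗ (antipodeSq k H).toLinearMap =
      (LinearMap.mulLeft k y ∘ₗ (antipodeSq k H).toLinearMap) ∘ₗ LinearMap.mulLeft k x := by
    ext z; simp [antipode_mul_antidistrib]
  rw [h1, h2, LinearMap.trace_comp_comm']

/-- The element `∑ h₁ q(h₂)`. -/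
noncomputable def coHit (h : H) (q : Dual k H) : H :=
  TensorProduct.rid k H (LinearMap.lTensor H q.ofConv (comul h))

omit [FiniteDimensional k H] in
theorem apply_coHit (h : H) (p q : Dual k H) : p (coHit h q) = (p * q) h := by
  rw [coHit, mul_apply_eq_pairing]
  generalize comul (R := k) h = t
  induction t with
  | zero => simp
  | tmul a b => simp [mul_comm]
  | add a b ha hb => simp only [map_add, ha, hb]

omit [FiniteDimensional k H] in
/-- `∑ Λ₁ μ(y Λ₂) = μ(Λ) S(y)`. -/
theorem coHit_translateLeft {Λ : H} (hΛ : IsNormalizedIntegral k Λ) {μ : Dual k H}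
    (hμ : IsLeftDualIntegral μ) (y : H) :
    coHit Λ (translateLeft y μ) = μ Λ • antipode k y := by
  refine eq_of_forall_dual_apply_eq (k := k) fun r => ?_
  rw [apply_coHit, mul_apply_eq_pairing, pairing_translateLeft_right,
    ← sum_antipode_tmul_mul_comul (ℛ k y), Finset.sum_mul, map_sum, dual_map_smul]
  have h1 : ∀ i ∈ (ℛ k y).index, pairing r μ ((antipode k ((ℛ k y).left i) ⊗ₜ[k] (1 : H)) *
      comul (R := k) ((ℛ k y).right i) * comul Λ) =
      μ Λ * (antipodeDual r ((ℛ k y).left i) * (1 : Dual k H) ((ℛ k y).right i)) := by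
    intro i _
    rw [mul_assoc, ← Bialgebra.comul_mul, hΛ.1, map_smul, mul_smul_comm, map_smul,
      ← pairing_translateLeft_left, ← mul_apply_eq_pairing, hμ, dual_smul_apply,
      translateLeft_apply, mul_one, antipodeDual_apply, dual_one_apply, smul_eq_mul]
    ring
  rw [Finset.sum_congr rfl h1, ← Finset.mul_sum, ← (ℛ k y).convMul_apply, mul_one]
  rfl

variable [IsSemisimpleRing H]

/-- `∑ Λ₁ λ(Λ₂ S(x)) = x`, where `λ` is the trace integral. -/
theorem coHit_translateRight_antipode {Λ : H} (hΛ : IsNormalizedIntegral k Λ) (x : H) :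
    coHit Λ (translateRight (antipode k x) (traceIntegral k H)) = x := by
  refine eq_of_forall_dual_apply_eq (k := k) fun r => ?_
  have h1 : comul (R := k) Λ * ((1 : H) ⊗ₜ[k] antipode k x) = comul (R := k) Λ * (x ⊗ₜ[k] (1 : H)) := by
    rw [← sum_comul_mul_tmul_antipode (ℛ k x), Finset.mul_sum]
    have h2 : ∀ i ∈ (ℛ k x).index, comul (R := k) Λ * (comul (R := k) ((ℛ k x).left i) *
        ((1 : H) ⊗ₜ[k] antipode k ((ℛ k x).right i))) =
        comul (R := k) Λ * ((1 : H) ⊗ₜ[k] antipode k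
          (counit (R := k) ((ℛ k x).left i) • (ℛ k x).right i)) := by
      intro i _
      rw [← mul_assoc, ← Bialgebra.comul_mul, hΛ.mul_right, map_smul, map_smul, smul_mul_assoc,
        TensorProduct.tmul_smul, mul_smul_comm]
    rw [Finset.sum_congr rfl h2, ← Finset.mul_sum, ← TensorProduct.tmul_sum, ← map_sum,
      sum_counit_smul]
  rw [apply_coHit, mul_apply_eq_pairing, pairing_translateRight_right, h1,
    ← pairing_translateRight_left, ← mul_apply_eq_pairing, isLeftDualIntegral_traceIntegral,
    dual_smul_apply, traceIntegral_integral hΛ, mul_one, translateRight_apply, one_mul]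

theorem antipode_injective {Λ : H} (hΛ : IsNormalizedIntegral k Λ) :
    Function.Injective (antipode k (A := H)) := fun x y h => by
  rw [← coHit_translateRight_antipode hΛ x, h, coHit_translateRight_antipode hΛ y]

theorem antipode_surjective {Λ : H} (hΛ : IsNormalizedIntegral k Λ) :
    Function.Surjective (antipode k (A := H)) :=
  LinearMap.injective_iff_surjective.1 (antipode_injective hΛ)

theorem eq_of_traceIntegral_mul_right {Λ : H} (hΛ : IsNormalizedIntegral k Λ) {x y : H}
    (h : ∀ z, traceIntegral k H (z * x) = traceIntegral k H (z * y)) : x = y := by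
  obtain ⟨x, rfl⟩ := antipode_surjective hΛ x
  obtain ⟨y, rfl⟩ := antipode_surjective hΛ y
  have : translateRight (antipode k x) (traceIntegral k H) =
      translateRight (antipode k y) (traceIntegral k H) := by
    ext z; exact h z
  rw [← coHit_translateRight_antipode hΛ x, this, coHit_translateRight_antipode hΛ y]

/-- Central elements are fixed by `S²`, because `λ(x z) = λ(z x) = λ(x S²(z))` for central `z` and
the form `λ(x y)` is nondegenerate. -/
theorem antipodeSq_eq_of_mem_center {Λ : H} (hΛ : IsNormalizedIntegral k Λ) {z : H}
    (hz : ∀ x, z * x = x * z) : antipodeSq k H z = z :=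
  eq_of_traceIntegral_mul_right hΛ fun x => by
    rw [← traceIntegral_mul_comm, hz]

omit [FiniteDimensional k H] [IsSemisimpleRing H] in
theorem comul_hitMap [FiniteDimensional k H] (p : Dual k H) (h : H) :
    comul (R := k) (hitMap p h) = LinearMap.rTensor H (hitMap p) (comul h) := by
  refine eq_of_forall_pairing_eq fun q r => ?_
  have h1 : ∀ t : H ⊗[k] H, pairing q r (LinearMap.rTensor H (hitMap p) t) =
      pairing (p * q) r t := by
    intro t
    induction t with
    | zero => simp
    | tmul x y => rw [LinearMap.rTensor_tmul, pairing_tmul, pairing_tmul, apply_hitMap]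
    | add x y hx hy => simp only [map_add, hx, hy]
  rw [h1, ← mul_apply_eq_pairing, ← mul_apply_eq_pairing, apply_hitMap, mul_assoc]

/-- The trace formula `Tr(S² ∘ (h ↦ ∑ p(h₁) h₂)) = λ(1) p(Λ)`. It follows from the expansion
`S = ∑ Λ₁ λ(· Λ₂)` of the antipode as a sum of operators of rank one. -/
theorem trace_antipodeSq_comp_hitMap {Λ : H} (hΛ : IsNormalizedIntegral k Λ) (p : Dual k H) :
    LinearMap.trace k H ((antipodeSq k H).toLinearMap ∘ₗ hitMap p) =
      traceIntegral k H 1 * p Λ := by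
  let S : H →ₗ[k] H := antipode k
  have h1 : LinearMap.trace k H ((antipodeSq k H).toLinearMap ∘ₗ hitMap p) =
      LinearMap.trace k H ((S ∘ₗ hitMap p) ∘ₗ S) :=
    LinearMap.trace_comp_comm' (S ∘ₗ hitMap p) S
  have h2 : S = ∑ i ∈ (ℛ k Λ).index,
      (translateRight ((ℛ k Λ).right i) (traceIntegral k H)).ofConv.smulRight ((ℛ k Λ).left i) := by
    ext y
    have h3 := coHit_translateLeft hΛ (isLeftDualIntegral_traceIntegral (k := k) (H := H)) y
    rw [traceIntegral_integral hΛ, one_smul, coHit, ← (ℛ k Λ).eq] at h3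
    rw [LinearMap.sum_apply]
    refine h3.symm.trans ?_
    simp only [map_sum, LinearMap.lTensor_tmul, TensorProduct.rid_tmul]
    rfl
  have h3 : (S ∘ₗ hitMap p) ∘ₗ S = ∑ i ∈ (ℛ k Λ).index,
      (translateRight ((ℛ k Λ).right i) (traceIntegral k H)).ofConv.smulRight
        (S (hitMap p ((ℛ k Λ).left i))) := by
    nth_rewrite 2 [h2]
    ext y
    simp only [LinearMap.comp_apply, LinearMap.sum_apply, map_sum, LinearMap.smulRight_apply,
      map_smul]
  have h4 : ∑ i ∈ (ℛ k Λ).index, S (hitMap p ((ℛ k Λ).left i)) * (ℛ k Λ).right i =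
      counit (R := k) (hitMap p Λ) • 1 := by
    have h5 := mul_antipode_rTensor_comul_apply (R := k) (hitMap p Λ)
    rw [comul_hitMap, ← (ℛ k Λ).eq] at h5
    simp only [map_sum, LinearMap.rTensor_tmul, LinearMap.mul'_apply] at h5
    rw [← Algebra.algebraMap_eq_smul_one]
    exact h5
  rw [h1, h3, map_sum]
  simp only [LinearMap.trace_smulRight]
  change ∑ i ∈ (ℛ k Λ).index,
    traceIntegral k H (S (hitMap p ((ℛ k Λ).left i)) * (ℛ k Λ).right i) = _
  rw [← dual_map_sum, h4, dual_map_smul, mul_comm, ← dual_one_apply, apply_hitMap, mul_one]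

/-- Left integrals of the dual algebra are unique up to scalars. -/
theorem IsLeftDualIntegral.eq_smul_traceIntegral {Λ : H} (hΛ : IsNormalizedIntegral k Λ)
    {μ : Dual k H} (hμ : IsLeftDualIntegral μ) : μ = μ Λ • traceIntegral k H := by
  let K : (H →ₗ[k] k) →ₗ[k] H :=
    { toFun := fun q => coHit Λ (toConv q)
      map_add' := fun p q => by simp [coHit, LinearMap.lTensor_add]
      map_smul' := fun c q => by simp [coHit, LinearMap.lTensor_smul] }
  -- `K` is surjective, hence injective, and takes proportional values at `μ` and `λ`
  have hK : Function.Injective K := by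
    refine (LinearMap.injective_iff_surjective_of_finrank_eq_finrank
      (Subspace.dual_finrank_eq (K := k) (V := H))).2 fun x => ?_
    exact ⟨_, coHit_translateRight_antipode hΛ x⟩
  have h1 := coHit_translateLeft hΛ hμ 1
  have h2 := coHit_translateLeft hΛ (isLeftDualIntegral_traceIntegral (k := k) (H := H)) 1
  rw [translateLeft_one] at h1 h2
  rw [traceIntegral_integral hΛ, one_smul] at h2
  apply ofConv_injective
  apply hK
  change coHit Λ μ = K (μ Λ • (traceIntegral k H).ofConv)
  rw [map_smul, h1, ← h2]
  rfl

end Integrals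

/-! ### The distinguished group-like element and the order of the antipode -/

section Radford
variable {k : Type v} [Field k] {H : Type u} [Ring H] [HopfAlgebra k H] [FiniteDimensional k H]
  [IsSemisimpleRing H]

/-- The distinguished element `∑ λ(Λ₁) Λ₂` of `H`. -/
noncomputable def distinguished (Λ : H) : H := hitMap (traceIntegral k H) Λ

theorem traceIntegral_mul {Λ : H} (hΛ : IsNormalizedIntegral k Λ) (q : Dual k H) :
    traceIntegral k H * q = q (distinguished (k := k) Λ) • traceIntegral k H := by
  have h1 : IsLeftDualIntegral (traceIntegral k H * q) := fun p => by
    rw [← mul_assoc, isLeftDualIntegral_traceIntegral, smul_mul_assoc]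
  have h2 := h1.eq_smul_traceIntegral hΛ
  rwa [← apply_hitMap] at h2

theorem isGroupLikeElem_distinguished {Λ : H} (hΛ : IsNormalizedIntegral k Λ) :
    IsGroupLikeElem k (distinguished (k := k) Λ) where
  counit_eq_one := by
    rw [distinguished, ← dual_one_apply, apply_hitMap, mul_one, traceIntegral_integral hΛ]
  comul_eq_tmul_self := by
    refine eq_of_forall_pairing_eq fun q r => ?_
    rw [← mul_apply_eq_pairing, pairing_tmul]
    conv_lhs => rw [distinguished, apply_hitMap, ← mul_assoc, traceIntegral_mul hΛ, smul_mul_assoc,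
      traceIntegral_mul hΛ]
    rw [dual_smul_apply, dual_smul_apply, traceIntegral_integral hΛ, mul_one]

theorem translateRight_distinguished_mul {Λ : H} (hΛ : IsNormalizedIntegral k Λ) (p : Dual k H) :
    translateRight (distinguished (k := k) Λ) (traceIntegral k H) * p =
      p 1 • translateRight (distinguished (k := k) Λ) (traceIntegral k H) := by
  set a := distinguished (k := k) Λ with ha
  have hg : IsGroupLikeElem k a := isGroupLikeElem_distinguished hΛ
  ext h
  have h1 : (a ⊗ₜ[k] (1 : H)) = comul (R := k) a * ((1 : H) ⊗ₜ[k] antipode k a) := by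
    rw [hg.comul_eq_tmul_self, Algebra.TensorProduct.tmul_mul_tmul, mul_one, hg.mul_antipode_cancel]
  rw [mul_apply_eq_pairing, pairing_translateRight_left, h1, ← mul_assoc, ← Bialgebra.comul_mul,
    ← pairing_translateRight_right, ← mul_apply_eq_pairing, traceIntegral_mul hΛ, dual_smul_apply,
    dual_smul_apply, translateRight_apply, translateRight_apply, ← ha, hg.mul_antipode_cancel]

/-- The functional `h ↦ λ(S(h) a)` is again a left integral, with value `1` at `Λ`. -/
theorem traceIntegral_antipode_mul_distinguished {Λ : H} (hΛ : IsNormalizedIntegral k Λ) (h : H) :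
    traceIntegral k H (antipode k h * distinguished (k := k) Λ) = traceIntegral k H h := by
  set a := distinguished (k := k) Λ with ha
  have hg : IsGroupLikeElem k a := isGroupLikeElem_distinguished hΛ
  let μ : Dual k H := antipodeDual (translateRight a (traceIntegral k H))
  have hμ : IsLeftDualIntegral μ := by
    intro p
    let e := LinearEquiv.ofBijective (antipode k (A := H))
      ⟨antipode_injective hΛ, antipode_surjective hΛ⟩
    obtain ⟨p, rfl⟩ : ∃ q : Dual k H, antipodeDual q = p :=
      ⟨toConv (p.ofConv ∘ₗ e.symm.toLinearMap), by
        ext x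
        exact congrArg p.ofConv (e.symm_apply_apply x)⟩
    ext x
    have h1 : (antipodeDual p * μ) x =
        (translateRight a (traceIntegral k H) * p) (antipode k x) := by
      rw [(ℛ k x).convMul_apply, mul_apply_eq_pairing, comul_antipode (ℛ k x), map_sum]
      exact Finset.sum_congr rfl fun i _ => mul_comm _ _
    rw [h1, translateRight_distinguished_mul hΛ, dual_smul_apply, dual_smul_apply,
      antipodeDual_apply, antipode_one, antipodeDual_apply]
  have hμΛ : μ Λ = 1 := by
    have h1 : antipode k Λ = Λ := by
      have h2 : ∀ x, antipode k Λ * x = counit (R := k) x • antipode k Λ := fun x => by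
        obtain ⟨x, rfl⟩ := antipode_surjective hΛ x
        rw [← antipode_mul_antidistrib, hΛ.1, map_smul, counit_antipode]
      have h3 := h2 Λ
      rw [hΛ.1, hΛ.2, counit_antipode, hΛ.2, one_smul, one_smul] at h3
      exact h3.symm
    change traceIntegral k H (antipode k Λ * a) = 1
    rw [h1, hΛ.mul_right, hg.counit_eq_one, one_smul, traceIntegral_integral hΛ]
  have h2 := hμ.eq_smul_traceIntegral hΛ
  rw [hμΛ, one_smul] at h2
  exact congrArg (fun f : Dual k H => f h) h2

theorem traceIntegral_antipode {Λ : H} (hΛ : IsNormalizedIntegral k Λ) (h : H) :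
    traceIntegral k H (antipode k h) = traceIntegral k H (h * distinguished (k := k) Λ) := by
  have hg := isGroupLikeElem_distinguished hΛ
  rw [← traceIntegral_antipode_mul_distinguished hΛ]
  have h1 := traceIntegral_mul_comm (k := k) (h * distinguished (k := k) Λ) 1
  rw [mul_one, one_mul, map_mul (antipodeSq k H), antipodeSq_apply (distinguished (k := k) Λ),
    hg.antipode_antipode] at h1
  exact h1.symm

/-- Radford's formula for the fourth power of the antipode of a semisimple Hopf algebra. -/
theorem distinguished_mul_antipodeSq_antipodeSq {Λ : H} (hΛ : IsNormalizedIntegral k Λ) (y : H) :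
    distinguished (k := k) Λ * antipodeSq k H (antipodeSq k H y) =
      y * distinguished (k := k) Λ := by
  refine eq_of_traceIntegral_mul_right hΛ fun x => ?_
  rw [← mul_assoc, ← traceIntegral_mul_comm, ← mul_assoc, ← mul_assoc, ← traceIntegral_antipode hΛ,
    ← traceIntegral_antipode hΛ, antipode_mul_antidistrib, antipode_mul_antidistrib,
    traceIntegral_mul_comm (antipode k y)]
  rfl

/-- The distinguished group-like element has finite order, since group-like elements are linearly
independent; hence so has `S⁴`. -/
theorem exists_antipodeSq_pow_eq_one {Λ : H} (hΛ : IsNormalizedIntegral k Λ) :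
    ∃ N : ℕ, 0 < N ∧ (antipodeSq k H).toLinearMap ^ N = 1 := by
  have hg := isGroupLikeElem_distinguished hΛ
  set a := distinguished (k := k) Λ with ha
  have : Finite (GroupLike k H) := (linearIndep_groupLikeVal (R := k) (A := H)).finite
  obtain ⟨n, hn, h1⟩ := (isOfFinOrder_of_finite (⟨a, hg⟩ : GroupLike k H)).exists_pow_eq_one
  have h2 : a ^ n = 1 := congrArg GroupLike.val h1
  have h3 : ∀ (m : ℕ) (y : H), a ^ m * (((antipodeSq k H).toLinearMap ^ (2 * m)) y) = y * a ^ m := by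
    intro m
    induction m with
    | zero => intro y; simp
    | succ m ih =>
      intro y
      have h4 : ((antipodeSq k H).toLinearMap ^ (2 * (m + 1))) y =
          antipodeSq k H (antipodeSq k H (((antipodeSq k H).toLinearMap ^ (2 * m)) y)) := by
        rw [show 2 * (m + 1) = 1 + (1 + 2 * m) by ring, pow_add, pow_add, pow_one]
        rfl
      rw [h4, pow_succ, mul_assoc, distinguished_mul_antipodeSq_antipodeSq hΛ, ← mul_assoc, ih,
        mul_assoc]
  refine ⟨2 * n, by omega, LinearMap.ext fun y => ?_⟩
  have h4 := h3 n y
  rwa [h2, one_mul, mul_one] at h4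

end Radford

/-! ### Operators of finite order -/

section FiniteOrder
variable {V : Type*} [AddCommGroup V] [Module ℂ V]

/-- The projection `N⁻¹ ∑_{k < N} w⁻ᵏ fᵏ` onto the `w`-eigenspace of an operator `f` with
`f ^ N = 1`, for `w ^ N = 1`. -/
noncomputable def eigenProj (N : ℕ) (f : Module.End ℂ V) (w : ℂ) : Module.End ℂ V :=
  (N : ℂ)⁻¹ • ∑ i ∈ Finset.range N, (w⁻¹ • f) ^ i

variable {N : ℕ} {f : Module.End ℂ V}

theorem mul_eigenProj (hf : f ^ N = 1) {w : ℂ} (hw : w ^ N = 1) (hN : 0 < N) :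
    f * eigenProj N f w = w • eigenProj N f w := by
  have hw0 : w ≠ 0 := fun h => by simp [h, hN.ne'] at hw
  have h1 : (w⁻¹ • f) * eigenProj N f w = eigenProj N f w := by
    have h2 : (w⁻¹ • f) ^ N = 1 := by rw [smul_pow, hf, inv_pow, hw, inv_one, one_smul]
    rw [eigenProj, mul_smul_comm, Finset.mul_sum]
    congr 1
    simp only [← pow_succ']
    have h3 := Finset.sum_range_succ (fun i => (w⁻¹ • f) ^ i) N
    rw [Finset.sum_range_succ', h2, pow_zero] at h3
    exact add_right_cancel h3
  rw [smul_mul_assoc] at h1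
  conv_rhs => rw [← h1, smul_smul, mul_inv_cancel₀ hw0, one_smul]

theorem pow_mul_eigenProj (hf : f ^ N = 1) {w : ℂ} (hw : w ^ N = 1) (hN : 0 < N) (k : ℕ) :
    f ^ k * eigenProj N f w = w ^ k • eigenProj N f w := by
  induction k with
  | zero => simp
  | succ k ih =>
    rw [pow_succ, mul_assoc, mul_eigenProj hf hw hN, mul_smul_comm, ih, smul_smul, pow_succ']

theorem isIdempotentElem_eigenProj (hf : f ^ N = 1) {w : ℂ} (hw : w ^ N = 1) (hN : 0 < N) :
    IsIdempotentElem (eigenProj N f w) := by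
  have hw0 : w ≠ 0 := fun h => by simp [h, hN.ne'] at hw
  have h1 : ∀ i, (w⁻¹ • f) ^ i * eigenProj N f w = eigenProj N f w := fun i => by
    rw [smul_pow, smul_mul_assoc, pow_mul_eigenProj hf hw hN, smul_smul, inv_pow,
      inv_mul_cancel₀ (pow_ne_zero _ hw0), one_smul]
  have h2 : eigenProj N f w * eigenProj N f w =
      (N : ℂ)⁻¹ • ∑ i ∈ Finset.range N, (w⁻¹ • f) ^ i * eigenProj N f w := by
    conv_lhs => enter [1]; rw [eigenProj]
    rw [smul_mul_assoc, Finset.sum_mul]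
  rw [IsIdempotentElem, h2, Finset.sum_congr rfl (fun i _ => h1 i), Finset.sum_const,
    Finset.card_range, ← Nat.cast_smul_eq_nsmul ℂ, smul_smul, inv_mul_cancel₀, one_smul]
  exact_mod_cast hN.ne'

theorem commute_eigenProj {g : Module.End ℂ V} (h : Commute g f) (w : ℂ) :
    Commute g (eigenProj N f w) :=
  (Commute.sum_right _ _ _ fun _ _ => (h.smul_right _).pow_right _).smul_right _

theorem sum_eigenProj {ζ : ℂ} (hζ : IsPrimitiveRoot ζ N) (hN : 0 < N) :
    ∑ j : Fin N, eigenProj N f (ζ ^ (j : ℕ)) = 1 := by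
  have hN0 : (N : ℂ) ≠ 0 := by exact_mod_cast hN.ne'
  have h1 : ∀ i ∈ Finset.range N, ∑ j : Fin N, ((ζ ^ (j : ℕ))⁻¹ • f) ^ i =
      if i = 0 then (N : ℂ) • 1 else 0 := by
    intro i hi
    have h2 : ∀ j : Fin N, ((ζ ^ (j : ℕ))⁻¹ • f) ^ i = ((ζ⁻¹ ^ i) ^ (j : ℕ)) • f ^ i := fun j => by
      rw [smul_pow, ← inv_pow, ← pow_mul, ← pow_mul, mul_comm]
    rw [Finset.sum_congr rfl fun j _ => h2 j, ← Finset.sum_smul,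
      Fin.sum_univ_eq_sum_range (fun j => (ζ⁻¹ ^ i) ^ j) N]
    split_ifs with h0
    · simp [h0]
    · have h3 : ζ⁻¹ ^ i ≠ 1 := hζ.inv.pow_ne_one_of_pos_of_lt h0 (Finset.mem_range.1 hi)
      rw [geom_sum_eq h3, ← pow_mul, mul_comm i, pow_mul, hζ.inv.pow_eq_one, one_pow, sub_self,
        zero_div, zero_smul]
  simp only [eigenProj]
  rw [← Finset.smul_sum, Finset.sum_comm, Finset.sum_congr rfl h1, Finset.sum_ite_eq']
  rw [if_pos (Finset.mem_range.2 hN), smul_smul, inv_mul_cancel₀ hN0, one_smul]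

theorem trace_eq_finrank_range {k V : Type*} [Field k] [AddCommGroup V] [Module k V]
    [FiniteDimensional k V] {e : Module.End k V} (he : IsIdempotentElem e) :
    LinearMap.trace k V e = (Module.finrank k (LinearMap.range e) : k) :=
  (LinearMap.IsIdempotentElem.isProj_range e he).trace

theorem trace_pow_mul {ζ : ℂ} (hζ : IsPrimitiveRoot ζ N) (hN : 0 < N) (hf : f ^ N = 1)
    (P : Module.End ℂ V) (i : ℕ) :
    LinearMap.trace ℂ V (f ^ i * P) =
      ∑ j : Fin N, LinearMap.trace ℂ V (eigenProj N f (ζ ^ (j : ℕ)) * P) * ζ ^ ((j : ℕ) * i) := by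
  have hw : ∀ j : ℕ, (ζ ^ j) ^ N = 1 := fun j => by
    rw [← pow_mul, mul_comm, pow_mul, hζ.pow_eq_one, one_pow]
  conv_lhs => rw [← mul_one (f ^ i), ← sum_eigenProj hζ hN (f := f), Finset.mul_sum, Finset.sum_mul]
  rw [map_sum]
  refine Finset.sum_congr rfl fun j _ => ?_
  rw [pow_mul_eigenProj hf (hw j) hN, smul_mul_assoc, map_smul, smul_eq_mul, mul_comm, pow_mul]

variable [FiniteDimensional ℂ V]

/-- If `f ^ N = 1` and the idempotent `P` commutes with `f`, then `Tr(fⁱ P)` is the sum of the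
`i`-th powers of the eigenvalues of `f` on the image of `P`. -/
theorem exists_trace_pow_mul_eq {ζ : ℂ} (hζ : IsPrimitiveRoot ζ N) (hN : 0 < N) (hf : f ^ N = 1)
    {P : Module.End ℂ V} (hP : IsIdempotentElem P) (hfP : Commute P f) :
    ∃ m : Fin N → ℕ, ∀ i, LinearMap.trace ℂ V (f ^ i * P) = ∑ j, (m j : ℂ) * ζ ^ ((j : ℕ) * i) := by
  have hw : ∀ j : ℕ, (ζ ^ j) ^ N = 1 := fun j => by
    rw [← pow_mul, mul_comm, pow_mul, hζ.pow_eq_one, one_pow]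
  refine ⟨fun j => Module.finrank ℂ (LinearMap.range (eigenProj N f (ζ ^ (j : ℕ)) * P)),
    fun i => ?_⟩
  rw [trace_pow_mul hζ hN hf]
  refine Finset.sum_congr rfl fun j _ => ?_
  rw [trace_eq_finrank_range]
  exact IsIdempotentElem.mul_of_commute (commute_eigenProj hfP _).symm
    (isIdempotentElem_eigenProj hf (hw j) hN) hP

/-- An operator of finite order with a nonzero fixed vector, whose trace has absolute value the
dimension, is the identity. -/
theorem eq_one_of_finrank_le_norm_trace (hN : 0 < N) (hf : f ^ N = 1) {v : V} (hv : v ≠ 0)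
    (hfv : f v = v) (h : (Module.finrank ℂ V : ℝ) ≤ ‖LinearMap.trace ℂ V f‖) : f = 1 := by
  obtain ⟨ζ, hζ⟩ : ∃ ζ : ℂ, IsPrimitiveRoot ζ N := ⟨_, Complex.isPrimitiveRoot_exp N hN.ne'⟩
  have hw : ∀ j : ℕ, (ζ ^ j) ^ N = 1 := fun j => by
    rw [← pow_mul, mul_comm, pow_mul, hζ.pow_eq_one, one_pow]
  have hnorm : ∀ j : ℕ, ‖ζ ^ j‖ = 1 := fun j => Complex.norm_eq_one_of_pow_eq_one (hw j) hN.ne'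
  let E := fun j : Fin N => eigenProj N f (ζ ^ (j : ℕ))
  have hE : ∀ j, IsIdempotentElem (E j) := fun j => isIdempotentElem_eigenProj hf (hw j) hN
  let m := fun j : Fin N => Module.finrank ℂ (LinearMap.range (E j))
  have hm : ∀ i, LinearMap.trace ℂ V (f ^ i) = ∑ j, (m j : ℂ) * ζ ^ ((j : ℕ) * i) := fun i => by
    have h1 := trace_pow_mul hζ hN hf 1 i
    simp only [mul_one] at h1
    rw [h1]
    exact Finset.sum_congr rfl fun j _ => by rw [trace_eq_finrank_range (hE j)]
  have hd : (Module.finrank ℂ V : ℝ) = ∑ j, (m j : ℝ) := by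
    have h1 := hm 0
    simp only [pow_zero, mul_zero, mul_one, LinearMap.trace_one] at h1
    exact_mod_cast h1
  set w := LinearMap.trace ℂ V f with hwdef
  have hw1 : w = ∑ j, (m j : ℂ) * ζ ^ (j : ℕ) := by simpa using hm 1
  have : Nontrivial V := ⟨v, 0, hv⟩
  have hwpos : 0 < ‖w‖ := lt_of_lt_of_le (by exact_mod_cast Module.finrank_pos) h
  -- rotate the trace to the positive real axis
  let u : ℂ := (starRingEnd ℂ) w / ‖w‖
  have hu : ‖u‖ = 1 := by simp [u, hwpos.ne']
  have huw : u * w = ‖w‖ := by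
    have : (‖w‖ : ℂ) ≠ 0 := by exact_mod_cast hwpos.ne'
    simp only [u]
    rw [div_mul_eq_mul_div, Complex.conj_mul', sq, mul_div_cancel_right₀ _ this]
  have hre : ∀ j : Fin N, (u * ζ ^ (j : ℕ)).re ≤ 1 := fun j =>
    (Complex.re_le_norm _).trans (by rw [norm_mul, hu, hnorm, one_mul])
  -- all summands are nonnegative, so every eigenvalue of `f` equals `u⁻¹`
  have hsum : ∑ j, (m j : ℝ) * (1 - (u * ζ ^ (j : ℕ)).re) ≤ 0 := by
    have h1 : ∑ j, (m j : ℝ) * (u * ζ ^ (j : ℕ)).re = ‖w‖ := by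
      have h2 : (u * w).re = ‖w‖ := by rw [huw, Complex.ofReal_re]
      rw [← h2, hw1, Finset.mul_sum, Complex.re_sum]
      refine Finset.sum_congr rfl fun j _ => ?_
      rw [← Complex.re_ofReal_mul, Complex.ofReal_natCast]
      congr 1
      ring
    simp only [mul_sub, mul_one, Finset.sum_sub_distrib, h1, ← hd]
    linarith
  have hzero : ∀ j, (m j : ℝ) * (1 - (u * ζ ^ (j : ℕ)).re) = 0 := by
    have h0 : ∀ j ∈ Finset.univ, 0 ≤ (m j : ℝ) * (1 - (u * ζ ^ (j : ℕ)).re) := fun j _ =>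
      mul_nonneg (Nat.cast_nonneg _) (sub_nonneg.2 (hre j))
    intro j
    exact (Finset.sum_eq_zero_iff_of_nonneg h0).1 (le_antisymm hsum (Finset.sum_nonneg h0)) j
      (Finset.mem_univ j)
  have hre1 : ∀ z : ℂ, ‖z‖ = 1 → z.re = 1 → z = 1 := fun z h1 h2 => by
    have h3 : z.re ^ 2 + z.im ^ 2 = 1 := by
      have := Complex.sq_norm z
      rw [h1, Complex.normSq_apply] at this
      linarith
    have h4 : z.im = 0 := by
      rw [h2] at h3
      exact pow_eq_zero_iff two_ne_zero |>.1 (by linarith)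
    exact Complex.ext (by simpa using h2) (by simpa using h4)
  have hmE : ∀ j, E j ≠ 0 → u * ζ ^ (j : ℕ) = 1 := by
    intro j hj
    have h1 : m j ≠ 0 := fun h0 => hj (by
      rw [← LinearMap.range_eq_bot]
      exact Submodule.finrank_eq_zero.1 h0)
    refine hre1 _ (by rw [norm_mul, hu, hnorm, one_mul]) ?_
    rcases mul_eq_zero.1 (hzero j) with h2 | h2
    · exact absurd (by exact_mod_cast h2) h1
    · linarith
  -- the fixed vector shows that this eigenvalue is `1`
  have hu1 : u = 1 := by
    have h1 : E ⟨0, hN⟩ v = v := by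
      simp only [E, eigenProj, pow_zero, inv_one, one_smul, LinearMap.smul_apply,
        LinearMap.sum_apply]
      have h2 : ∀ i : ℕ, (f ^ i) v = v := fun i => by
        induction i with
        | zero => simp
        | succ i ih => rw [pow_succ, Module.End.mul_apply, hfv, ih]
      simp only [h2, Finset.sum_const, Finset.card_range]
      rw [← Nat.cast_smul_eq_nsmul ℂ, smul_smul, inv_mul_cancel₀, one_smul]
      exact_mod_cast hN.ne'
    have h3 := hmE ⟨0, hN⟩ (fun h0 => hv (by rw [← h1, h0]; rfl))
    simpa using h3
  have h1 : f * 1 = 1 * 1 := by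
    rw [← sum_eigenProj hζ hN (f := f), Finset.mul_sum]
    rw [sum_eigenProj hζ hN, one_mul, ← sum_eigenProj hζ hN (f := f)]
    refine Finset.sum_congr rfl fun j _ => ?_
    rw [mul_eigenProj hf (hw j) hN]
    by_cases h0 : E j = 0
    · change _ • E j = E j
      rw [h0, smul_zero]
    · have := hmE j h0
      rw [hu1, one_mul] at this
      rw [this, one_smul]
  simpa using h1

end FiniteOrder

/-! ### Sums of roots of unity -/

section NumberTheory

/-- Let a nonempty sum of `d` roots of unity be nonzero. If its quotient by `d` is an integral
combination of roots of unity, then its absolute value is at least `d`: all conjugates of the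
quotient have absolute value at most one, while the norm of the quotient is a nonzero integer. -/
theorem le_norm_sum_of_dvd {N : ℕ} (hN : 0 < N) {ζ : ℂ} (hζ : ζ ^ N = 1) {d : ℕ}
    (m m' : Fin N → ℕ) (hd : ∑ j, m j = d) (hd0 : 0 < d)
    (h : (d : ℂ) * ∑ j, (m' j : ℂ) * ζ ^ (j : ℕ) = ∑ j, (m j : ℂ) * ζ ^ (j : ℕ))
    (h0 : ∑ j, (m j : ℂ) * ζ ^ (j : ℕ) ≠ 0) :
    (d : ℝ) ≤ ‖∑ j, (m j : ℂ) * ζ ^ (j : ℕ)‖ := by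
  have hint : IsIntegral ℤ ζ := IsIntegral.of_pow hN (by rw [hζ]; exact isIntegral_one)
  have hQ : IsIntegral ℚ ζ := hint.tower_top
  let K := IntermediateField.adjoin ℚ {ζ}
  have : FiniteDimensional ℚ K := IntermediateField.adjoin.finiteDimensional hQ
  let z : K := IntermediateField.AdjoinSimple.gen ℚ ζ
  let D : K := ∑ j : Fin N, (m' j : K) * z ^ (j : ℕ)
  have hzN : z ^ N = 1 := by
    apply Subtype.ext
    simpa [z] using hζ
  have hzint : IsIntegral ℤ z := IsIntegral.of_pow hN (by rw [hzN]; exact isIntegral_one)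
  have hDint : IsIntegral ℤ D := IsIntegral.sum _ fun j _ =>
    IsIntegral.mul (by simpa using isIntegral_algebraMap (R := ℤ) (A := K) (x := (m' j : ℤ))) (hzint.pow _)
  have hdD : (d : K) * D = ∑ j, (m j : K) * z ^ (j : ℕ) := by
    apply Subtype.ext
    simpa [D, z] using h
  have hd0' : (d : ℝ) ≠ 0 := by exact_mod_cast hd0.ne'
  have hconj : ∀ σ : K →ₐ[ℚ] ℂ, ‖σ D‖ ≤ 1 := by
    intro σ
    have h1 : (d : ℂ) * σ D = ∑ j, (m j : ℂ) * (σ z) ^ (j : ℕ) := by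
      have := congrArg σ hdD
      simpa using this
    have h2 : ‖σ z‖ = 1 := Complex.norm_eq_one_of_pow_eq_one (by rw [← map_pow, hzN, map_one]) hN.ne'
    have h3 : (d : ℝ) * ‖σ D‖ ≤ d := by
      have h4 : ‖(d : ℂ) * σ D‖ = d * ‖σ D‖ := by rw [norm_mul, Complex.norm_natCast]
      rw [← h4, h1]
      refine (norm_sum_le _ _).trans ?_
      simp only [norm_mul, norm_pow, h2, one_pow, mul_one, Complex.norm_natCast]
      exact_mod_cast hd.le
    have : (0 : ℝ) < d := by exact_mod_cast hd0
    nlinarith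
  have hD0 : D ≠ 0 := by
    intro h1
    apply h0
    have h2 : (D : ℂ) = ∑ j, (m' j : ℂ) * ζ ^ (j : ℕ) := by simp [D, z]
    rw [← h, ← h2, h1]
    simp
  obtain ⟨n, hn⟩ := IsIntegrallyClosed.isIntegral_iff.1 (Algebra.isIntegral_norm ℚ hDint)
  have hn0 : n ≠ 0 := by
    rintro rfl
    exact hD0 (Algebra.norm_eq_zero_iff.1 (by rw [← hn]; simp))
  have hprod := Algebra.norm_eq_prod_embeddings ℚ ℂ D
  rw [← hn] at hprod
  -- the norm of `D` is a nonzero integer, and all factors but one are at most `1`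
  have h1 : (1 : ℝ) ≤ ∏ σ : K →ₐ[ℚ] ℂ, ‖σ D‖ := by
    rw [← norm_prod, ← hprod]
    have : (1 : ℝ) ≤ |(n : ℝ)| := by exact_mod_cast Int.one_le_abs hn0
    simpa using this
  classical
  rw [← Finset.mul_prod_erase Finset.univ (fun σ : K →ₐ[ℚ] ℂ => ‖σ D‖) (Finset.mem_univ K.val)] at h1
  have h2 : ∏ σ ∈ Finset.univ.erase K.val, ‖σ D‖ ≤ 1 :=
    Finset.prod_le_one (fun _ _ => norm_nonneg _) fun σ _ => hconj σ
  have h3 : 1 ≤ ‖K.val D‖ :=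
    h1.trans (mul_le_of_le_one_right (norm_nonneg _) h2)
  have h4 : K.val D = ∑ j, (m' j : ℂ) * ζ ^ (j : ℕ) := by simp [D, z]
  rw [← h, ← h4, norm_mul, Complex.norm_natCast]
  exact le_mul_of_one_le_right (Nat.cast_nonneg _) h3

end NumberTheory

/-! ### Traces of automorphisms of semisimple algebras -/

section Blocks

/-- The operator `x ↦ a x b` on `Hom(W, V) ≅ W^* ⊗ V` has trace `Tr(a) Tr(b)`. -/
theorem trace_comp_comp {k V W : Type*} [CommRing k] [AddCommGroup V] [Module k V]
    [Module.Free k V] [Module.Finite k V] [AddCommGroup W] [Module k W] [Module.Free k W]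
    [Module.Finite k W]
    (a : Module.End k V) (b : Module.End k W) (T : Module.End k (W →ₗ[k] V))
    (hT : ∀ x, T x = a ∘ₗ x ∘ₗ b) :
    LinearMap.trace k (W →ₗ[k] V) T = LinearMap.trace k V a * LinearMap.trace k W b := by
  have h1 : T = (dualTensorHomEquiv k W V).conj
      (TensorProduct.map (Module.Dual.transpose (R := k) b) a) := by
    ext x : 1
    obtain ⟨t, rfl⟩ := (dualTensorHomEquiv k W V).surjective x
    rw [LinearEquiv.conj_apply_apply, LinearEquiv.symm_apply_apply, hT]
    induction t with
    | zero => simp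
    | tmul f v =>
      ext w
      simp [dualTensorHomEquiv, Module.Dual.transpose_apply]
    | add s t hs ht => rw [map_add, map_add, map_add, ← hs, ← ht]; ext; simp
  have h2 := LinearMap.trace_conj' (R := k) (M := Module.Dual k W ⊗[k] V) (N := W →ₗ[k] V)
    (TensorProduct.map (Module.Dual.transpose (R := k) b) a) (dualTensorHomEquiv k W V)
  rw [h1, h2, LinearMap.trace_tensorProduct', LinearMap.trace_transpose',
    mul_comm]

theorem trace_pi {k : Type*} [Field k] {ι : Type*} [Fintype ι] [DecidableEq ι] {M : ι → Type*}
    [∀ i, AddCommGroup (M i)] [∀ i, Module k (M i)] [∀ i, FiniteDimensional k (M i)]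
    (T : Module.End k (Π i, M i)) :
    LinearMap.trace k _ T =
      ∑ i, LinearMap.trace k (M i) (LinearMap.proj i ∘ₗ T ∘ₗ LinearMap.single k M i) := by
  have h1 : T = ∑ i, (T ∘ₗ LinearMap.single k M i) ∘ₗ LinearMap.proj i := by
    ext i x : 2
    simp only [LinearMap.comp_apply, LinearMap.sum_apply, LinearMap.proj_apply]
    rw [← map_sum T]
    simp only [LinearMap.coe_single, Finset.univ_sum_single]
  conv_lhs => rw [h1, map_sum]
  exact Finset.sum_congr rfl fun i _ => LinearMap.trace_comp_comm' _ _

/-- For an inner automorphism `x ↦ t x t⁻¹` of finite order, `Tr(t) Tr(t⁻¹)` is a nonnegative real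
number, which vanishes only if `Tr(t⁻¹)` does: after scaling, `t` has finite order, so its
eigenvalues are roots of unity and `Tr(t⁻¹)` is the complex conjugate of `Tr(t)`. -/
theorem trace_mul_trace_symm {V : Type*} [AddCommGroup V] [Module ℂ V] [FiniteDimensional ℂ V]
    (t : V ≃ₗ[ℂ] V) {N : ℕ} (hN : 0 < N)
    (ht : ∀ x : Module.End ℂ V, Commute (t.toLinearMap ^ N : Module.End ℂ V) x) :
    ∃ r : ℝ, 0 ≤ r ∧ LinearMap.trace ℂ V t.toLinearMap * LinearMap.trace ℂ V t.symm.toLinearMap = r ∧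
      (r = 0 → LinearMap.trace ℂ V t.symm.toLinearMap = 0) := by
  rcases subsingleton_or_nontrivial V with hV | hV
  · refine ⟨0, le_rfl, ?_, fun _ => ?_⟩
    · rw [Subsingleton.elim t.toLinearMap 0]; simp
    · rw [Subsingleton.elim t.symm.toLinearMap 0]; simp
  obtain ⟨c, hc⟩ : ∃ c : ℂ, (t.toLinearMap ^ N : Module.End ℂ V) = c • 1 := by
    have h1 : (t.toLinearMap ^ N : Module.End ℂ V) ∈ Subalgebra.center ℂ (Module.End ℂ V) :=
      Subalgebra.mem_center_iff.2 fun x => (ht x).symm.eq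
    rw [Algebra.IsCentral.center_eq_bot, Algebra.mem_bot] at h1
    obtain ⟨c, hc⟩ := h1
    exact ⟨c, by rw [← hc, Algebra.algebraMap_eq_smul_one]⟩
  have htt : (t.toLinearMap : Module.End ℂ V) * t.symm.toLinearMap = 1 := by
    ext x; exact t.apply_symm_apply x
  have hc0 : c ≠ 0 := by
    rintro rfl
    rw [zero_smul] at hc
    have h1 : Function.Injective (t.toLinearMap ^ N : Module.End ℂ V) := by
      rw [Module.End.coe_pow]
      exact t.injective.iterate N
    obtain ⟨v, hv⟩ := exists_ne (0 : V)
    exact hv (h1 (by rw [hc]; simp))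
  -- `t ^ N` is a scalar, so a multiple `g` of `t` satisfies `g ^ N = 1`
  obtain ⟨w, hw⟩ := IsAlgClosed.exists_pow_nat_eq c⁻¹ hN
  have hw0 : w ≠ 0 := by
    rintro rfl
    rw [zero_pow hN.ne'] at hw
    exact inv_ne_zero hc0 hw.symm
  let g : Module.End ℂ V := w • t.toLinearMap
  let g' : Module.End ℂ V := w⁻¹ • t.symm.toLinearMap
  have hg : g ^ N = 1 := by
    simp only [g, smul_pow, hw, hc, smul_smul, inv_mul_cancel₀ hc0, one_smul]
  have hgg' : g * g' = 1 := by
    simp only [g, g', smul_mul_assoc, mul_smul_comm, smul_smul, htt, inv_mul_cancel₀ hw0, one_smul]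
  have hg' : g ^ (N - 1) = g' := by
    rw [← mul_one (g ^ (N - 1)), ← hgg', ← mul_assoc, ← pow_succ, Nat.sub_add_cancel hN, hg,
      one_mul]
  obtain ⟨ζ, hζ⟩ : ∃ ζ : ℂ, IsPrimitiveRoot ζ N := ⟨_, Complex.isPrimitiveRoot_exp N hN.ne'⟩
  obtain ⟨m, hm⟩ := exists_trace_pow_mul_eq hζ hN hg (P := 1) IsIdempotentElem.one
    (Commute.one_left g)
  simp only [mul_one] at hm
  -- the eigenvalues of `g` are roots of unity and `g' = g⁻¹`
  have hconj : LinearMap.trace ℂ V g' = (starRingEnd ℂ) (LinearMap.trace ℂ V g) := by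
    have h1 := hm 1
    rw [pow_one] at h1
    rw [← hg', hm, h1, map_sum]
    refine Finset.sum_congr rfl fun j _ => ?_
    rw [map_mul, map_natCast, map_pow, mul_one]
    congr 1
    have h2 : (starRingEnd ℂ) ζ = ζ⁻¹ :=
      (Complex.inv_eq_conj (Complex.norm_eq_one_of_pow_eq_one hζ.pow_eq_one hN.ne')).symm
    have h3 : ζ ^ (N - 1) = ζ⁻¹ := by
      refine eq_inv_of_mul_eq_one_left ?_
      rw [← pow_succ, Nat.sub_add_cancel hN, hζ.pow_eq_one]
    rw [h2, mul_comm (j : ℕ), pow_mul, h3]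
  have htg : LinearMap.trace ℂ V t.toLinearMap = w⁻¹ * LinearMap.trace ℂ V g := by
    simp only [g, map_smul, smul_eq_mul, inv_mul_cancel_left₀ hw0]
  have htg' : LinearMap.trace ℂ V t.symm.toLinearMap = w * LinearMap.trace ℂ V g' := by
    simp only [g', map_smul, smul_eq_mul, mul_inv_cancel_left₀ hw0]
  refine ⟨Complex.normSq (LinearMap.trace ℂ V g), Complex.normSq_nonneg _, ?_, fun h => ?_⟩
  · rw [htg, htg', ← Complex.mul_conj, ← hconj]
    field_simp
  · rw [htg', hconj, Complex.normSq_eq_zero.1 h, map_zero, mul_zero]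

/-- For an automorphism `σ` of finite order of a product of matrix algebras, given as endomorphism
algebras, which fixes the center pointwise, `Tr(σ) = 0` forces `Tr(x ↦ h σ(x)) = 0` for all `h`:
on each factor `σ` is inner, so both traces are computed by `trace_comp_comp`. -/
theorem trace_mulLeft_comp_eq_zero_pi {ι : Type*} [Fintype ι] [DecidableEq ι] (V : ι → Type*)
    [∀ i, AddCommGroup (V i)] [∀ i, Module ℂ (V i)] [∀ i, FiniteDimensional ℂ (V i)]
    [∀ i, Nontrivial (V i)]
    (σ : (Π i, Module.End ℂ (V i)) →ₐ[ℂ] (Π i, Module.End ℂ (V i))) {N : ℕ} (hN : 0 < N)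
    (hσ : σ.toLinearMap ^ N = 1)
    (hcenter : ∀ i, σ (Pi.single i 1) = Pi.single i 1)
    (h0 : LinearMap.trace ℂ _ σ.toLinearMap = 0) (h : Π i, Module.End ℂ (V i)) :
    LinearMap.trace ℂ _ (LinearMap.mulLeft ℂ h ∘ₗ σ.toLinearMap) = 0 := by
  let τ := fun i => ((LinearMap.proj i ∘ₗ σ.toLinearMap ∘ₗ
    LinearMap.single ℂ (fun i => Module.End ℂ (V i)) i) : Module.End ℂ (Module.End ℂ (V i)))
  have hτ : ∀ i x, τ i x = σ (Pi.single i x) i := fun i x => rfl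
  have hsingle : ∀ i x, σ (Pi.single i x) = Pi.single i (τ i x) := by
    intro i x
    have h1 : (Pi.single i x : Π i, Module.End ℂ (V i)) = Pi.single i 1 * Pi.single i x := by
      rw [← Pi.single_mul, one_mul]
    rw [h1, map_mul, hcenter]
    ext j : 1
    by_cases hj : j = i
    · subst hj
      rw [Pi.mul_apply, Pi.single_eq_same, Pi.single_eq_same, one_mul, hτ]
    · rw [Pi.mul_apply, Pi.single_eq_of_ne hj, Pi.single_eq_of_ne hj, zero_mul]
  have hone : ∀ i, τ i 1 = 1 := fun i => by rw [hτ, hcenter, Pi.single_eq_same]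
  have hmul : ∀ i x y, τ i (x * y) = τ i x * τ i y := fun i x y => by
    rw [hτ, Pi.single_mul, map_mul, Pi.mul_apply]
    rfl
  let α := fun i => AlgHom.ofLinearMap (τ i) (hone i) (hmul i)
  have hinner : ∀ i, ∃ t : V i ≃ₗ[ℂ] V i, ∀ x : Module.End ℂ (V i),
      τ i x = t.toLinearMap ∘ₗ x ∘ₗ t.symm.toLinearMap := by
    intro i
    have hinj : Function.Injective (τ i) := fun x y hxy => by
      have h1 : σ (Pi.single i x) = σ (Pi.single i y) := by rw [hsingle, hsingle, hxy]
      have h2 : ∀ z, (σ.toLinearMap ^ (N - 1)) (σ z) = z := fun z => by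
        have h3 : (σ.toLinearMap ^ (N - 1)) (σ.toLinearMap z) = (σ.toLinearMap ^ N) z := by
          rw [← Module.End.mul_apply, ← pow_succ, Nat.sub_add_cancel hN]
        rw [hσ] at h3
        exact h3
      have h4 := congrArg (σ.toLinearMap ^ (N - 1)) h1
      rw [h2, h2] at h4
      exact Pi.single_injective i h4
    have hb : Function.Bijective (α i) := ⟨hinj, LinearMap.injective_iff_surjective.1 hinj⟩
    obtain ⟨t, ht⟩ := (AlgEquiv.ofBijective (α i) hb).eq_linearEquivConjAlgEquiv
    refine ⟨t, fun x => ?_⟩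
    have h1 := congrArg (fun e => e x) ht
    exact h1
  choose t ht using hinner
  have hpow : ∀ (n : ℕ) i x, (σ.toLinearMap ^ n) (Pi.single i x) =
      Pi.single i ((t i).toLinearMap ^ n * x * (t i).symm.toLinearMap ^ n) := by
    intro n i
    induction n with
    | zero => intro x; simp
    | succ n ih =>
      intro x
      rw [pow_succ', Module.End.mul_apply, ih]
      refine (hsingle _ _).trans ?_
      rw [ht, pow_succ', pow_succ]
      rfl
  have htN : ∀ i (x : Module.End ℂ (V i)), Commute ((t i).toLinearMap ^ N : Module.End ℂ (V i)) x := by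
    intro i x
    have h1 := hpow N i x
    rw [hσ, Module.End.one_apply] at h1
    have h2 := Pi.single_injective i h1
    have h3 : ((t i).symm.toLinearMap ^ N : Module.End ℂ (V i)) * (t i).toLinearMap ^ N = 1 := by
      have h4 : ((t i).symm.toLinearMap : Module.End ℂ (V i)) * (t i).toLinearMap = 1 := by
        ext x; exact (t i).symm_apply_apply x
      have h5 : ((t i).toLinearMap : Module.End ℂ (V i)) * (t i).symm.toLinearMap = 1 := by
        ext x; exact (t i).apply_symm_apply x
      rw [← Commute.mul_pow (h4.trans h5.symm), h4, one_pow]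
    change _ * x = x * _
    conv_rhs => rw [h2, mul_assoc, h3, mul_one]
  have hpos := fun i => trace_mul_trace_symm (t i) hN (htN i)
  choose r hr0 hr hr1 using hpos
  have htrace : ∀ h : Π i, Module.End ℂ (V i),
      LinearMap.trace ℂ _ (LinearMap.mulLeft ℂ h ∘ₗ σ.toLinearMap) =
      ∑ i, LinearMap.trace ℂ (V i) (h i * (t i).toLinearMap) *
        LinearMap.trace ℂ (V i) (t i).symm.toLinearMap := by
    intro h
    rw [trace_pi]
    refine Finset.sum_congr rfl fun i _ => ?_
    refine trace_comp_comp _ _ _ fun x => ?_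
    change h i * σ (Pi.single i x) i = _
    rw [← hτ, ht]
    rfl
  have h1 := htrace 1
  have h2 : LinearMap.mulLeft ℂ (1 : Π i, Module.End ℂ (V i)) ∘ₗ σ.toLinearMap = σ.toLinearMap :=
    LinearMap.ext fun x => one_mul _
  rw [h2, h0] at h1
  simp only [Pi.one_apply, one_mul, hr] at h1
  have h3 : ∑ i, r i = 0 := by exact_mod_cast h1.symm
  rw [htrace]
  refine Finset.sum_eq_zero fun i _ => ?_
  rw [hr1 i ((Finset.sum_eq_zero_iff_of_nonneg fun i _ => hr0 i).1 h3 i (Finset.mem_univ i)),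
    mul_zero]

/-- For an automorphism `σ` of finite order of a semisimple complex algebra which fixes the center
pointwise, `Tr(σ) = 0` forces `Tr(x ↦ h σ(x)) = 0` for all `h`. -/
theorem trace_mulLeft_comp_eq_zero {A : Type*} [Ring A] [Algebra ℂ A] [FiniteDimensional ℂ A]
    [IsSemisimpleRing A] (σ : A →ₐ[ℂ] A) {N : ℕ} (hN : 0 < N) (hσ : σ.toLinearMap ^ N = 1)
    (hcenter : ∀ z : A, (∀ x, z * x = x * z) → σ z = z)
    (h0 : LinearMap.trace ℂ A σ.toLinearMap = 0) (h : A) :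
    LinearMap.trace ℂ A (LinearMap.mulLeft ℂ h ∘ₗ σ.toLinearMap) = 0 := by
  obtain ⟨n, d, hd, ⟨e₁⟩⟩ := IsSemisimpleRing.exists_algEquiv_pi_matrix_of_isAlgClosed ℂ A
  let e : A ≃ₐ[ℂ] (Π i, Module.End ℂ (Fin (d i) → ℂ)) :=
    e₁.trans (AlgEquiv.piCongrRight fun i => Matrix.toLinAlgEquiv')
  have : ∀ i, Nonempty (Fin (d i)) := fun i => ⟨0, Nat.pos_of_ne_zero (hd i).out⟩
  let ρ : (Π i, Module.End ℂ (Fin (d i) → ℂ)) →ₐ[ℂ] (Π i, Module.End ℂ (Fin (d i) → ℂ)) :=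
    (e.toAlgHom.comp σ).comp e.symm.toAlgHom
  have hρ : ρ.toLinearMap = e.toLinearEquiv.conj σ.toLinearMap := by
    ext x : 1
    rfl
  have key := trace_mulLeft_comp_eq_zero_pi (fun i => Fin (d i) → ℂ) ρ hN ?_ ?_ ?_ (e h)
  · rw [← key, ← LinearMap.trace_conj' _ e.toLinearEquiv]
    congr 1
    refine LinearMap.ext fun x => ?_
    simp [LinearEquiv.conj_apply, ρ]
  · have : e.toLinearEquiv.conj (σ.toLinearMap ^ N) = ρ.toLinearMap ^ N := by
      rw [hρ]
      exact map_pow (e.toLinearEquiv.conjAlgEquiv ℂ) _ _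
    rw [← this, hσ]
    exact map_one (e.toLinearEquiv.conjAlgEquiv ℂ)
  · intro i
    have h1 : σ (e.symm (Pi.single i 1)) = e.symm (Pi.single i 1) := by
      refine hcenter _ fun x => e.injective ?_
      rw [map_mul, map_mul, e.apply_symm_apply]
      ext j : 1
      by_cases hj : j = i
      · subst hj; simp
      · simp [Pi.single_eq_of_ne hj]
    change e (σ (e.symm _)) = _
    rw [h1, e.apply_symm_apply]
  · rw [hρ, LinearMap.trace_conj', h0]

end Blocks

/-! ### The regular character -/

section RegularCharacter
variable {k : Type v} [Field k] {H : Type u} [Ring H] [HopfAlgebra k H]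

variable (k H) in
/-- The character of the left regular representation. -/
noncomputable def regularCharacter : Dual k H :=
  toConv (LinearMap.trace k H ∘ₗ LinearMap.mul k H)

theorem regularCharacter_apply (h : H) :
    regularCharacter k H h = LinearMap.trace k H (LinearMap.mulLeft k h) := rfl

theorem comul_antipodeSq (h : H) : comul (R := k) (antipodeSq k H h) =
    TensorProduct.map (antipodeSq k H).toLinearMap (antipodeSq k H).toLinearMap (comul h) := by
  let r := ℛ k h
  let s : Coalgebra.Repr k (antipode k h) (H × H) :=
    { index := r.index
      left := fun i => antipode k (r.right i)
      right := fun i => antipode k (r.left i)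
      eq := (comul_antipode r).symm }
  rw [antipodeSq_apply, comul_antipode s, ← r.eq, map_sum]
  rfl

/-- If `p` is invariant under `S²` then `S²` commutes with `h ↦ ∑ p(h₁) h₂`. -/
theorem commute_hitMap_antipodeSq {p : Dual k H} (hp : ∀ h, p (antipodeSq k H h) = p h) :
    Commute (hitMap p : Module.End k H) (antipodeSq k H).toLinearMap := by
  refine LinearMap.ext fun h => eq_of_forall_dual_apply_eq (k := k) fun q => ?_
  let q' : Dual k H := toConv (q.ofConv ∘ₗ (antipodeSq k H).toLinearMap)
  change q (hitMap p (antipodeSq k H h)) = q' (hitMap p h)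
  rw [apply_hitMap, apply_hitMap, mul_apply_eq_pairing, mul_apply_eq_pairing, comul_antipodeSq]
  generalize comul (R := k) h = t
  induction t with
  | zero => simp
  | tmul a b =>
    rw [TensorProduct.map_tmul, pairing_tmul, pairing_tmul, AlgHom.toLinearMap_apply, hp]
    rfl
  | add a b ha hb => simp only [map_add, ha, hb]

theorem regularCharacter_antipodeSq {N : ℕ} (hN : 0 < N)
    (hA : (antipodeSq k H).toLinearMap ^ N = 1) (h : H) :
    regularCharacter k H (antipodeSq k H h) = regularCharacter k H h := by
  let A : Module.End k H := (antipodeSq k H).toLinearMap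
  have h1 : A * LinearMap.mulLeft k h = LinearMap.mulLeft k (antipodeSq k H h) * A :=
    LinearMap.ext fun x => map_mul (antipodeSq k H) h x
  have h2 : A * A ^ (N - 1) = 1 := by rw [← pow_succ', Nat.sub_add_cancel hN, hA]
  have h3 : A ^ (N - 1) * A = 1 := by rw [← pow_succ, Nat.sub_add_cancel hN, hA]
  rw [regularCharacter_apply, regularCharacter_apply,
    ← mul_one (LinearMap.mulLeft k (antipodeSq k H h) : Module.End k H), ← h2, ← mul_assoc, ← h1,
    mul_assoc, LinearMap.trace_mul_comm, mul_assoc, h3, mul_one]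

variable [FiniteDimensional k H]

instance finiteDimensional_dual : FiniteDimensional k (Dual k H) :=
  Module.Finite.equiv (WithConv.linearEquiv k (H →ₗ[k] k)).symm

/-- The tensor square of the regular representation is free: it is isomorphic to the tensor product
of the regular representation and a trivial one. -/
theorem regularCharacter_mul_self : regularCharacter k H * regularCharacter k H =
    (Module.finrank k H : k) • regularCharacter k H := by
  ext h
  have htr : ∀ t : H ⊗[k] H, pairing (regularCharacter k H) (regularCharacter k H) t =
      LinearMap.trace k (H ⊗[k] H) (LinearMap.mulLeft k t) := by
    intro t
    induction t with
    | zero => simp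
    | tmul a b =>
      rw [pairing_tmul, regularCharacter_apply, regularCharacter_apply,
        ← LinearMap.trace_tensorProduct']
      congr 1
      ext x y
      simp
    | add a b ha hb => rw [map_add, ha, hb, ← map_add]; congr 1; ext; simp [add_mul]
  let Φ : H ⊗[k] H →ₗ[k] H ⊗[k] H := TensorProduct.lift
    (((LinearMap.mul k (H ⊗[k] H)).comp (Bialgebra.comulAlgHom k H).toLinearMap).compl₂
      (Algebra.TensorProduct.includeRight : H →ₐ[k] H ⊗[k] H).toLinearMap)
  have hΦ : ∀ x v : H, Φ (x ⊗ₜ v) = comul x * ((1 : H) ⊗ₜ v) := fun x v => rfl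
  have hsurj : Function.Surjective Φ := by
    rw [← LinearMap.range_eq_top, eq_top_iff, ← TensorProduct.span_tmul_eq_top, Submodule.span_le]
    rintro _ ⟨x, v, rfl⟩
    refine ⟨∑ i ∈ (ℛ k x).index, (ℛ k x).left i ⊗ₜ (antipode k ((ℛ k x).right i) * v), ?_⟩
    have h1 := congrArg (fun t => t * ((1 : H) ⊗ₜ[k] v)) (sum_comul_mul_tmul_antipode (ℛ k x))
    simp only [Finset.sum_mul, mul_assoc, Algebra.TensorProduct.tmul_mul_tmul, mul_one,
      one_mul] at h1
    rw [map_sum]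
    exact h1
  let e := LinearEquiv.ofBijective Φ ⟨LinearMap.injective_iff_surjective.2 hsurj, hsurj⟩
  have hconj : LinearMap.mulLeft k (comul (R := k) h) =
      e.conj (TensorProduct.map (LinearMap.mulLeft k h) LinearMap.id) := by
    refine LinearMap.ext fun y => ?_
    obtain ⟨y, rfl⟩ := e.surjective y
    rw [LinearEquiv.conj_apply_apply, LinearEquiv.symm_apply_apply]
    change comul h * Φ y = Φ _
    induction y with
    | zero => simp
    | tmul a b =>
      rw [TensorProduct.map_tmul, hΦ, hΦ, ← mul_assoc, ← Bialgebra.comul_mul]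
      rfl
    | add a b ha hb => simp only [map_add, mul_add, ha, hb]
  rw [mul_apply_eq_pairing, htr, hconj, LinearMap.trace_conj', LinearMap.trace_tensorProduct',
    LinearMap.trace_id, mul_comm]
  rfl

theorem regularCharacter_integral [IsSemisimpleRing H] {Λ : H} (hΛ : IsNormalizedIntegral k Λ) :
    regularCharacter k H Λ = 1 := by
  have h1 : LinearMap.mulLeft k Λ = (counit : H →ₗ[k] k).smulRight Λ := by
    ext x
    simp [hΛ.mul_right]
  rw [regularCharacter_apply, h1, LinearMap.trace_smulRight, hΛ.2]

end RegularCharacter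

/-! ### The antipode is an involution -/

section LarsonRadford
variable {H : Type u} [Ring H] [HopfAlgebra ℂ H] [FiniteDimensional ℂ H] [IsSemisimpleRing H]

omit [IsSemisimpleRing H] in
theorem finrank_ne_zero_of_integral {Λ : H} (hΛ : IsNormalizedIntegral ℂ Λ) :
    (Module.finrank ℂ H : ℂ) ≠ 0 := by
  have : Nontrivial H := ⟨Λ, 0, fun h => by
    have := hΛ.2
    rw [h, map_zero] at this
    exact zero_ne_one this⟩
  exact Nat.cast_ne_zero.2 Module.finrank_pos.ne'

/-- Larson–Radford: the antipode of a semisimple complex Hopf algebra is an involution. The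
idempotent `e = χ / dim H`, with `χ` the regular character, gives `Tr(S²) / dim H = Tr(S² ∘ P_e)`
with `P_e` an idempotent commuting with `S²`. So `Tr(S²) / dim H` is an algebraic integer, and all
its conjugates have absolute value at most one. -/
theorem antipodeSq_eq_one {Λ : H} (hΛ : IsNormalizedIntegral ℂ Λ) :
    (antipodeSq ℂ H).toLinearMap = 1 := by
  obtain ⟨N, hN, hA⟩ := exists_antipodeSq_pow_eq_one hΛ
  have hd := finrank_ne_zero_of_integral hΛ
  have hH : Nontrivial H := Module.finrank_pos_iff.1 (Nat.pos_of_ne_zero (Nat.cast_ne_zero.1 hd))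
  let e : Dual ℂ H := (Module.finrank ℂ H : ℂ)⁻¹ • regularCharacter ℂ H
  have he : e * e = e := by
    simp only [e, smul_mul_assoc, mul_smul_comm, regularCharacter_mul_self, smul_smul]
    rw [inv_mul_cancel₀ hd, mul_one]
  have heA : ∀ h, e (antipodeSq ℂ H h) = e h := fun h => by
    simp only [e, dual_smul_apply]
    rw [regularCharacter_antipodeSq hN hA]
  have hP : IsIdempotentElem (hitMap e : Module.End ℂ H) := by
    have := hitMap_comp_hitMap e e
    rwa [he] at this
  obtain ⟨ζ, hζ⟩ : ∃ ζ : ℂ, IsPrimitiveRoot ζ N := ⟨_, Complex.isPrimitiveRoot_exp N hN.ne'⟩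
  obtain ⟨m', hm'⟩ := exists_trace_pow_mul_eq hζ hN hA hP (commute_hitMap_antipodeSq heA)
  obtain ⟨m, hm⟩ := exists_trace_pow_mul_eq hζ hN hA (P := 1) IsIdempotentElem.one
    (Commute.one_left _)
  have hc : LinearMap.trace ℂ H (antipodeSq ℂ H).toLinearMap = traceIntegral ℂ H 1 := by
    rw [traceIntegral_apply]
    congr 1
    ext x
    simp
  have h1 := hm 1
  have h1' := hm' 1
  have h0 := hm 0
  simp only [pow_one, mul_one, mul_zero, pow_zero, LinearMap.trace_one] at h1 h1' h0
  have h2 := trace_antipodeSq_comp_hitMap hΛ e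
  have h3 : e Λ = (Module.finrank ℂ H : ℂ)⁻¹ := by
    simp only [e, dual_smul_apply, regularCharacter_integral hΛ, mul_one]
  rw [h3, ← hc] at h2
  rw [Module.End.mul_eq_comp, h2, h1] at h1'
  refine eq_one_of_finrank_le_norm_trace hN hA (v := (1 : H)) one_ne_zero
    (map_one (antipodeSq ℂ H)) ?_
  rw [h1]
  refine le_norm_sum_of_dvd hN hζ.pow_eq_one m m' (by exact_mod_cast h0.symm) Module.finrank_pos ?_ ?_
  · rw [← h1']
    field_simp
  · rw [← h1]
    intro hc0
    have h4 := trace_mulLeft_comp_eq_zero (antipodeSq ℂ H) hN hA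
      (fun z hz => antipodeSq_eq_of_mem_center hΛ hz) hc0 Λ
    rw [← traceIntegral_apply, traceIntegral_integral hΛ] at h4
    exact one_ne_zero h4

theorem antipode_antipode {Λ : H} (hΛ : IsNormalizedIntegral ℂ Λ) (x : H) :
    antipode ℂ (antipode ℂ x) = x :=
  LinearMap.congr_fun (antipodeSq_eq_one hΛ) x

/-- The trace of the left regular representation of `H^*` is `dim H` times evaluation at `Λ`:
left multiplication by `p` is the transpose of `hitMap p`, whose trace is given by
`trace_antipodeSq_comp_hitMap` with `S² = 1`. -/
theorem trace_mulLeft_dual {Λ : H} (hΛ : IsNormalizedIntegral ℂ Λ) (p : Dual ℂ H) :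
    LinearMap.trace ℂ (Dual ℂ H) (LinearMap.mulLeft ℂ p) = Module.finrank ℂ H * p Λ := by
  have h1 := trace_antipodeSq_comp_hitMap hΛ p
  have h2 : traceIntegral ℂ H 1 = Module.finrank ℂ H := by
    rw [traceIntegral_apply, antipodeSq_eq_one hΛ, LinearMap.mulLeft_one, ← LinearMap.trace_id]
    rfl
  have h3 : (antipodeSq ℂ H).toLinearMap ∘ₗ hitMap p = hitMap p := by
    rw [antipodeSq_eq_one hΛ]; rfl
  rw [h3, h2] at h1
  have h4 : LinearMap.mulLeft ℂ p = (WithConv.linearEquiv ℂ (H →ₗ[ℂ] ℂ)).symm.conj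
      (Module.Dual.transpose (R := ℂ) (hitMap p)) := by
    ext q h
    exact (apply_hitMap p q h).symm
  rw [← h1, h4]
  exact (LinearMap.trace_conj' _ _).trans (LinearMap.trace_transpose' (hitMap p))

theorem dimRightIdeal_dual {Λ : H} (hΛ : IsNormalizedIntegral ℂ Λ) {p : Dual ℂ H}
    (hp : IsIdempotentElem p) : (dimRightIdeal ℂ p : ℂ) = Module.finrank ℂ H * p Λ := by
  rw [← trace_mulLeft_dual hΛ, dimRightIdeal, trace_eq_finrank_range]
  exact LinearMap.ext fun q => by
    change p * (p * q) = p * q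
    rw [← mul_assoc, hp.eq]

theorem integral_eq_zero_of_isNilpotent {Λ : H} (hΛ : IsNormalizedIntegral ℂ Λ) {p : Dual ℂ H}
    (hp : IsNilpotent p) : p Λ = 0 := by
  have h1 : IsNilpotent (LinearMap.mulLeft ℂ p) := by
    obtain ⟨n, hn⟩ := hp
    exact ⟨n, by rw [LinearMap.pow_mulLeft, hn, LinearMap.mulLeft_zero_eq_zero]⟩
  have h2 := (LinearMap.isNilpotent_trace_of_isNilpotent h1).eq_zero
  rw [trace_mulLeft_dual hΛ] at h2
  exact (mul_eq_zero.1 h2).resolve_left (finrank_ne_zero_of_integral hΛ)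

end LarsonRadford

/-! ### Characters of representations -/

section TraceCharacters
variable {H : Type u} [Ring H] [HopfAlgebra ℂ H]

/-- `p` is the character of a finite-dimensional representation of `H`. -/
def IsTraceCharacter (p : Dual ℂ H) : Prop :=
  ∃ (U : Type u) (_ : AddCommGroup U) (_ : Module ℂ U) (_ : Module.Finite ℂ U)
    (ρ : H →ₐ[ℂ] Module.End ℂ U), p = toConv (LinearMap.trace ℂ U ∘ₗ ρ.toLinearMap)

theorem IsIrreducibleCharacter.isTraceCharacter {p : Dual ℂ H} (hp : IsIrreducibleCharacter ℂ H p) :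
    IsTraceCharacter p := by
  obtain ⟨V, _, _, _, _, _, hV, rfl⟩ := hp
  exact ⟨V, _, _, hV, Algebra.lsmul ℂ ℂ V, rfl⟩

theorem IsTraceCharacter.mem_characterSpan [IsSemisimpleRing H] {p : Dual ℂ H}
    (hp : IsTraceCharacter p) : p ∈ characterSpan ℂ H := by
  obtain ⟨U, _, _, _, ρ, rfl⟩ := hp
  exact trace_mem_span ℂ H U ρ

theorem IsTraceCharacter.mul {p q : Dual ℂ H} (hp : IsTraceCharacter p) (hq : IsTraceCharacter q) :
    IsTraceCharacter (p * q) := by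
  obtain ⟨V, _, _, _, ρ, rfl⟩ := hp
  obtain ⟨W, _, _, _, σ, rfl⟩ := hq
  let φ : H ⊗[ℂ] H →ₐ[ℂ] Module.End ℂ (V ⊗[ℂ] W) :=
    (Module.endTensorEndAlgHom (R := ℂ) (A := ℂ) (M := V) (N := W)).comp
      (Algebra.TensorProduct.map ρ σ)
  refine ⟨V ⊗[ℂ] W, _, _, inferInstance, φ.comp (Bialgebra.comulAlgHom ℂ H), ?_⟩
  ext h
  rw [mul_apply_eq_pairing]
  change _ = LinearMap.trace ℂ (V ⊗[ℂ] W) (φ (comul h))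
  generalize comul (R := ℂ) h = t
  induction t with
  | zero => simp
  | tmul a b =>
    rw [pairing_tmul]
    simp only [φ, AlgHom.comp_apply, Algebra.TensorProduct.map_tmul,
      Module.endTensorEndAlgHom_apply]
    exact (LinearMap.trace_tensorProduct' _ _).symm
  | add a b ha hb => simp only [map_add, ha, hb]

theorem IsTraceCharacter.comp_antipode {p : Dual ℂ H} (hp : IsTraceCharacter p) :
    IsTraceCharacter (antipodeDual p) := by
  obtain ⟨V, _, _, _, ρ, rfl⟩ := hp
  refine ⟨Module.Dual ℂ V, inferInstance, inferInstance, inferInstance,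
    AlgHom.ofLinearMap (Module.Dual.transpose (R := ℂ) ∘ₗ ρ.toLinearMap ∘ₗ antipode ℂ) ?_ ?_, ?_⟩
  · ext f v
    simp [Module.Dual.transpose_apply]
  · intro x y
    ext f v
    simp [Module.Dual.transpose_apply, antipode_mul_antidistrib]
  · ext h
    exact (LinearMap.trace_transpose' (ρ (antipode ℂ h))).symm

theorem IsTraceCharacter.exists_nat {p : Dual ℂ H} (hp : IsTraceCharacter p) {Λ : H}
    (hΛ : IsNormalizedIntegral ℂ Λ) : ∃ n : ℕ, p Λ = n := by
  obtain ⟨V, _, _, _, ρ, rfl⟩ := hp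
  refine ⟨_, trace_eq_finrank_range (e := ρ Λ) ?_⟩
  rw [IsIdempotentElem, ← map_mul, hΛ.1, hΛ.2, one_smul]

theorem antipodeDual_mul (p q : Dual ℂ H) :
    antipodeDual (p * q) = antipodeDual q * antipodeDual p := by
  ext h
  rw [antipodeDual_apply, mul_apply_eq_pairing, comul_antipode (ℛ ℂ h), map_sum,
    (ℛ ℂ h).convMul_apply]
  exact Finset.sum_congr rfl fun i _ => mul_comm _ _

theorem antipodeDual_sum_smul {ι : Type*} (s : Finset ι) (a : ι → ℂ) (p : ι → Dual ℂ H) :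
    antipodeDual (∑ i ∈ s, a i • p i) = ∑ i ∈ s, a i • antipodeDual (p i) := by
  ext h
  simp only [antipodeDual_apply, dual_sum_apply, dual_smul_apply]

end TraceCharacters

/-! ### Orthogonality of irreducible characters -/

section Orthogonality
variable {H : Type u} [Ring H] [HopfAlgebra ℂ H]
variable (V W : Type u) [AddCommGroup V] [Module ℂ V] [Module H V] [IsScalarTower ℂ H V]
  [AddCommGroup W] [Module ℂ W] [Module H W] [IsScalarTower ℂ H W]

/-- The map sending `a ⊗ b` to the operator `x ↦ a x S(b)` on `Hom(W, V)`. -/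
noncomputable def homAction : H ⊗[ℂ] H →ₗ[ℂ] Module.End ℂ (W →ₗ[ℂ] V) :=
  TensorProduct.lift ((LinearMap.mul ℂ (Module.End ℂ (W →ₗ[ℂ] V))).compl₁₂
    ((LinearMap.llcomp ℂ W V V) ∘ₗ (Algebra.lsmul ℂ ℂ V : H →ₐ[ℂ] Module.End ℂ V).toLinearMap)
    ((LinearMap.llcomp ℂ W W V).flip ∘ₗ
      (Algebra.lsmul ℂ ℂ W : H →ₐ[ℂ] Module.End ℂ W).toLinearMap ∘ₗ antipode ℂ))

theorem homAction_tmul (a b : H) (x : W →ₗ[ℂ] V) (w : W) :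
    homAction V W (a ⊗ₜ b) x w = a • x (antipode ℂ b • w) := rfl

variable {V W}

theorem homAction_left_mul (a : H) (t : H ⊗[ℂ] H) (x : W →ₗ[ℂ] V) (w : W) :
    homAction V W ((a ⊗ₜ 1) * t) x w = a • homAction V W t x w := by
  induction t with
  | zero => simp
  | tmul b c =>
    rw [Algebra.TensorProduct.tmul_mul_tmul, one_mul, homAction_tmul, homAction_tmul, mul_smul]
  | add s t hs ht =>
    rw [mul_add, map_add, map_add, LinearMap.add_apply, LinearMap.add_apply, LinearMap.add_apply,
      LinearMap.add_apply, hs, ht, smul_add]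

theorem homAction_right_mul (a : H) (t : H ⊗[ℂ] H) (x : W →ₗ[ℂ] V) (w : W) :
    homAction V W ((1 ⊗ₜ a) * t) x w = homAction V W t x (antipode ℂ a • w) := by
  induction t with
  | zero => simp
  | tmul b c =>
    rw [Algebra.TensorProduct.tmul_mul_tmul, one_mul, homAction_tmul, homAction_tmul,
      antipode_mul_antidistrib, mul_smul]
  | add s t hs ht =>
    rw [mul_add, map_add, map_add, LinearMap.add_apply, LinearMap.add_apply, LinearMap.add_apply,
      LinearMap.add_apply, hs, ht]

theorem homAction_comul_of_commute (x : W →ₗ[ℂ] V) (hx : ∀ (h : H) w, x (h • w) = h • x w) (h : H) :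
    homAction V W (comul h) x = counit (R := ℂ) h • x := by
  have key : ∀ (t : H ⊗[ℂ] H) w, homAction V W t x w =
      (LinearMap.mul' ℂ H (LinearMap.lTensor H (antipode ℂ) t)) • x w := by
    intro t w
    induction t with
    | zero => simp
    | tmul b c =>
      rw [homAction_tmul, hx, LinearMap.lTensor_tmul, LinearMap.mul'_apply, mul_smul]
    | add s t hs ht =>
      rw [map_add, LinearMap.add_apply, LinearMap.add_apply, hs, ht, map_add, map_add, add_smul]
  ext w
  rw [key, mul_antipode_lTensor_comul_apply, algebraMap_smul]
  rfl

theorem trace_homAction_comul [Module.Finite ℂ V] [Module.Finite ℂ W] (t : H ⊗[ℂ] H) :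
    LinearMap.trace ℂ _ (homAction V W t) =
      pairing (character ℂ H V) (antipodeDual (character ℂ H W)) t := by
  induction t with
  | zero => simp
  | tmul a b =>
    rw [pairing_tmul]
    exact trace_comp_comp _ _ _ fun x => rfl
  | add s t hs ht => rw [map_add, map_add, map_add, hs, ht]

variable [FiniteDimensional ℂ H] [IsSemisimpleRing H]

/-- Averaging over the integral produces `H`-linear maps. -/
theorem homAction_integral_commute {Λ : H} (hΛ : IsNormalizedIntegral ℂ Λ) (x : W →ₗ[ℂ] V) (h : H)
    (w : W) : homAction V W (comul Λ) x (h • w) = h • homAction V W (comul Λ) x w := by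
  obtain ⟨h, rfl⟩ := antipode_surjective hΛ h
  rw [← homAction_right_mul, ← homAction_left_mul]
  congr 3
  rw [← sum_antipode_tmul_mul_comul (ℛ ℂ h), Finset.sum_mul]
  have h1 : ∀ i ∈ (ℛ ℂ h).index, (antipode ℂ ((ℛ ℂ h).left i) ⊗ₜ[ℂ] (1 : H)) *
      comul (R := ℂ) ((ℛ ℂ h).right i) * comul Λ =
      (antipode ℂ (counit (R := ℂ) ((ℛ ℂ h).right i) • (ℛ ℂ h).left i) ⊗ₜ[ℂ] (1 : H)) * comul Λ := by
    intro i _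
    rw [mul_assoc, ← Bialgebra.comul_mul, hΛ.1, map_smul, map_smul, ← TensorProduct.smul_tmul',
      smul_mul_assoc, mul_smul_comm]
  have h2 : ∑ i ∈ (ℛ ℂ h).index, counit (R := ℂ) ((ℛ ℂ h).right i) • (ℛ ℂ h).left i = h := by
    have h3 := congrArg (TensorProduct.rid ℂ H) (sum_tmul_counit_eq (R := ℂ) (ℛ ℂ h))
    simp only [map_sum, TensorProduct.rid_tmul, one_smul] at h3
    exact h3
  rw [Finset.sum_congr rfl h1, ← Finset.sum_mul, ← TensorProduct.sum_tmul, ← map_sum, h2]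

theorem IsIrreducibleCharacter.integral_mul_self {Λ : H} (hΛ : IsNormalizedIntegral ℂ Λ)
    {p : Dual ℂ H} (hp : IsIrreducibleCharacter ℂ H p) : (p * antipodeDual p) Λ = 1 := by
  obtain ⟨V, _, _, _, _, hV, _, rfl⟩ := hp
  rw [mul_apply_eq_pairing, ← trace_homAction_comul]
  set Φ := homAction V V (comul (R := ℂ) Λ) with hΦ
  have hone : Φ LinearMap.id = LinearMap.id := by
    rw [hΦ, homAction_comul_of_commute _ (fun _ _ => rfl), hΛ.2, one_smul]
  have hscal : ∀ x, ∃ c : ℂ, Φ x = c • LinearMap.id := by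
    intro x
    let y : Module.End H V :=
      { toFun := Φ x
        map_add' := map_add _
        map_smul' := fun h w => homAction_integral_commute hΛ x h w }
    obtain ⟨c, hc⟩ := (IsSimpleModule.algebraMap_end_bijective_of_isAlgClosed (A := H) (V := V) ℂ).2 y
    refine ⟨c, LinearMap.ext fun w => ?_⟩
    have := LinearMap.congr_fun hc w
    exact this.symm
  have hidem : IsIdempotentElem Φ := by
    refine LinearMap.ext fun x => ?_
    obtain ⟨c, hc⟩ := hscal x
    rw [Module.End.mul_apply, hc, map_smul, hone]
  have hrange : LinearMap.range Φ = Submodule.span ℂ {LinearMap.id} := by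
    apply le_antisymm
    · rintro _ ⟨x, rfl⟩
      obtain ⟨c, hc⟩ := hscal x
      rw [hc]
      exact Submodule.smul_mem _ _ (Submodule.mem_span_singleton_self _)
    · rw [Submodule.span_singleton_le_iff_mem]
      exact ⟨_, hone⟩
  have : Nontrivial V := IsSimpleModule.nontrivial H V
  have hid : (LinearMap.id : V →ₗ[ℂ] V) ≠ 0 := one_ne_zero (α := Module.End ℂ V)
  rw [trace_eq_finrank_range hidem, hrange, finrank_span_singleton hid, Nat.cast_one]

theorem IsIrreducibleCharacter.integral_mul_of_ne {Λ : H} (hΛ : IsNormalizedIntegral ℂ Λ)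
    {p q : Dual ℂ H} (hp : IsIrreducibleCharacter ℂ H p) (hq : IsIrreducibleCharacter ℂ H q)
    (hpq : p ≠ q) : (p * antipodeDual q) Λ = 0 := by
  obtain ⟨V, _, _, _, _, hV, _, rfl⟩ := hp
  obtain ⟨W, _, _, _, _, hW, _, rfl⟩ := hq
  rw [mul_apply_eq_pairing, ← trace_homAction_comul]
  have hzero : homAction V W (comul (R := ℂ) Λ) = 0 := by
    refine LinearMap.ext fun x => ?_
    let y : W →ₗ[H] V :=
      { toFun := homAction V W (comul (R := ℂ) Λ) x
        map_add' := map_add _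
        map_smul' := fun h w => homAction_integral_commute hΛ x h w }
    rcases LinearMap.bijective_or_eq_zero y with hy | hy
    · exfalso
      apply hpq
      let e : W ≃ₗ[H] V := LinearEquiv.ofBijective y hy
      ext h
      have h1 : (Algebra.lsmul ℂ ℂ V : H →ₐ[ℂ] Module.End ℂ V) h = (e.restrictScalars ℂ).conj
          ((Algebra.lsmul ℂ ℂ W : H →ₐ[ℂ] Module.End ℂ W) h) := by
        refine LinearMap.ext fun v => ?_
        obtain ⟨w, rfl⟩ := (e.restrictScalars ℂ).surjective v
        rw [LinearEquiv.conj_apply_apply, LinearEquiv.symm_apply_apply]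
        exact (e.map_smul h w).symm
      change LinearMap.trace ℂ V ((Algebra.lsmul ℂ ℂ V : H →ₐ[ℂ] Module.End ℂ V) h) =
        LinearMap.trace ℂ W ((Algebra.lsmul ℂ ℂ W : H →ₐ[ℂ] Module.End ℂ W) h)
      rw [h1, LinearMap.trace_conj']
    · refine LinearMap.ext fun w => ?_
      exact LinearMap.congr_fun hy w
  rw [hzero, map_zero]

end Orthogonality

/-! ### The positive involution of the character algebra -/

section Dagger
variable {H : Type u} [Ring H] [HopfAlgebra ℂ H] {Λ : H} {n : ℕ}
  (χ : Fin n ≃ {χ : Dual ℂ H // IsIrreducibleCharacter ℂ H χ})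

/-- The conjugate-linear involution of the character algebra, `∑ aᵢ χᵢ ↦ ∑ āᵢ χᵢ ∘ S`. The
coefficient `aᵢ` of `p` is recovered as the value of `p * (χᵢ ∘ S)` at the integral. -/
noncomputable def dagger (Λ : H) (p : Dual ℂ H) : Dual ℂ H :=
  ∑ i, (starRingEnd ℂ) ((p * antipodeDual (χ i).1) Λ) • antipodeDual (χ i).1

theorem dagger_add (p q : Dual ℂ H) : dagger χ Λ (p + q) = dagger χ Λ p + dagger χ Λ q := by
  simp only [dagger, ← Finset.sum_add_distrib, ← add_smul, ← map_add, add_mul]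
  rfl

theorem dagger_smul (a : ℂ) (p : Dual ℂ H) :
    dagger χ Λ (a • p) = (starRingEnd ℂ) a • dagger χ Λ p := by
  simp only [dagger, Finset.smul_sum, smul_smul, ← map_mul, smul_mul_assoc]
  rfl

theorem dagger_zero : dagger χ Λ (0 : Dual ℂ H) = 0 := by
  have := dagger_smul (Λ := Λ) χ 0 0
  simpa using this

/-- The hermitian form `(p, q) ↦ (p * q†)(Λ)` is positive definite on the character algebra. -/
theorem integral_mul_dagger (p : Dual ℂ H) : (p * dagger χ Λ p) Λ =
    ((∑ i, Complex.normSq ((p * antipodeDual (χ i).1) Λ) : ℝ) : ℂ) := by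
  rw [dagger, Finset.mul_sum, dual_sum_apply, Complex.ofReal_sum]
  refine Finset.sum_congr rfl fun i _ => ?_
  rw [mul_smul_comm, dual_smul_apply, mul_comm, Complex.mul_conj]

theorem dagger_mem [IsSemisimpleRing H] (p : Dual ℂ H) : dagger χ Λ p ∈ characterSpan ℂ H :=
  Submodule.sum_mem _ fun i _ => Submodule.smul_mem _ _
    (χ i).2.isTraceCharacter.comp_antipode.mem_characterSpan

variable [FiniteDimensional ℂ H] [IsSemisimpleRing H] (hΛ : IsNormalizedIntegral ℂ Λ)

include hΛ in
theorem integral_mul_antipodeDual (i j : Fin n) :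
    ((χ i).1 * antipodeDual (χ j).1) Λ = if i = j then 1 else 0 := by
  split_ifs with h
  · rw [h]
    exact (χ j).2.integral_mul_self hΛ
  · exact (χ i).2.integral_mul_of_ne hΛ (χ j).2 fun h1 => h (χ.injective (Subtype.ext h1))

include hΛ in
theorem eq_sum_characters {p : Dual ℂ H} (hp : p ∈ characterSpan ℂ H) :
    p = ∑ i, (p * antipodeDual (χ i).1) Λ • (χ i).1 := by
  induction hp using Submodule.span_induction with
  | mem x hx =>
    obtain ⟨j, hj⟩ := χ.surjective ⟨x, hx⟩
    have hj' : (χ j).1 = x := by rw [hj]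
    rw [← hj']
    simp only [integral_mul_antipodeDual χ hΛ, ite_smul, one_smul, zero_smul]
    rw [Finset.sum_ite_eq, if_pos (Finset.mem_univ j)]
  | zero => simp
  | add x y _ _ hx hy =>
    conv_lhs => rw [hx, hy]
    rw [← Finset.sum_add_distrib]
    refine Finset.sum_congr rfl fun i _ => ?_
    rw [← add_smul, add_mul]
    rfl
  | smul a x _ hx =>
    conv_lhs => rw [hx]
    rw [Finset.smul_sum]
    refine Finset.sum_congr rfl fun i _ => ?_
    rw [smul_smul, smul_mul_assoc]
    rfl

include hΛ in
/-- The coefficients of the character of a representation are natural numbers. -/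
theorem IsTraceCharacter.dagger_eq {p : Dual ℂ H} (hp : IsTraceCharacter p) :
    dagger χ Λ p = antipodeDual p := by
  conv_rhs => rw [eq_sum_characters χ hΛ hp.mem_characterSpan, antipodeDual_sum_smul]
  refine Finset.sum_congr rfl fun i _ => ?_
  obtain ⟨m, hm⟩ := (hp.mul (χ i).2.isTraceCharacter.comp_antipode).exists_nat hΛ
  rw [hm, map_natCast]

include hΛ in
theorem dagger_mul {p q : Dual ℂ H} (hp : p ∈ characterSpan ℂ H) (hq : q ∈ characterSpan ℂ H) :
    dagger χ Λ (p * q) = dagger χ Λ q * dagger χ Λ p := by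
  refine Submodule.span_induction₂
    (p := fun a b _ _ => dagger χ Λ (a * b) = dagger χ Λ b * dagger χ Λ a) ?_ ?_ ?_ ?_ ?_ ?_ ?_ hp hq
  · intro a b ha hb
    have ha' := IsIrreducibleCharacter.isTraceCharacter ha
    have hb' := IsIrreducibleCharacter.isTraceCharacter hb
    rw [(ha'.mul hb').dagger_eq χ hΛ, ha'.dagger_eq χ hΛ, hb'.dagger_eq χ hΛ, antipodeDual_mul]
  · intro a _; simp [dagger_zero]
  · intro a _; simp [dagger_zero]
  · intro a b c _ _ _ h1 h2; rw [add_mul, dagger_add, h1, h2, dagger_add, mul_add]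
  · intro a b c _ _ _ h1 h2; rw [mul_add, dagger_add, h1, h2, dagger_add, add_mul]
  · intro r a b _ _ h; rw [smul_mul_assoc, dagger_smul, h, dagger_smul, mul_smul_comm]
  · intro r a b _ _ h; rw [mul_smul_comm, dagger_smul, h, dagger_smul, smul_mul_assoc]

include hΛ in
theorem dagger_dagger {p : Dual ℂ H} (hp : p ∈ characterSpan ℂ H) :
    dagger χ Λ (dagger χ Λ p) = p := by
  induction hp using Submodule.span_induction with
  | mem x hx =>
    have hx' := IsIrreducibleCharacter.isTraceCharacter hx
    rw [hx'.dagger_eq χ hΛ, hx'.comp_antipode.dagger_eq χ hΛ]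
    ext h
    rw [antipodeDual_apply, antipodeDual_apply, antipode_antipode hΛ]
  | zero => rw [dagger_zero, dagger_zero]
  | add x y _ _ hx hy => rw [dagger_add, dagger_add, hx, hy]
  | smul a x _ hx => rw [dagger_smul, dagger_smul, hx, Complex.conj_conj]

include hΛ in
theorem eq_zero_of_integral_mul_dagger {p : Dual ℂ H} (hp : p ∈ characterSpan ℂ H)
    (h : (p * dagger χ Λ p) Λ = 0) : p = 0 := by
  rw [integral_mul_dagger] at h
  have h1 : ∑ i, Complex.normSq ((p * antipodeDual (χ i).1) Λ) = 0 := by exact_mod_cast h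
  rw [eq_sum_characters χ hΛ hp]
  refine Finset.sum_eq_zero fun i _ => ?_
  rw [Complex.normSq_eq_zero.1 ((Finset.sum_eq_zero_iff_of_nonneg
    fun i _ => Complex.normSq_nonneg _).1 h1 i (Finset.mem_univ i)), zero_smul]

end Dagger

/-! ### Primitive idempotents of semisimple algebras -/

section Corner
variable {R : Type*} [Ring R]

/-- In a semisimple finite-dimensional algebra over an algebraically closed field the corner ring of
a primitive idempotent `e` consists of scalars: the left ideal `R e` is simple, and `e R e` acts on
it by endomorphisms. -/
theorem IsPrimitiveIdempotent.exists_corner_eq_smul {k : Type*} [Field k] [IsAlgClosed k]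
    [Algebra k R] [FiniteDimensional k R] [IsSemisimpleRing R] {e : R}
    (he : IsPrimitiveIdempotent e) (x : R) : ∃ c : k, e * x * e = c • e := by
  obtain ⟨hidem, hne, hprim⟩ := he
  let M : Submodule R R := Ideal.span {e}
  have hmem : ∀ y ∈ M, y * e = y := fun y hy => by
    obtain ⟨a, rfl⟩ := Ideal.mem_span_singleton'.1 hy
    rw [mul_assoc, hidem.eq]
  have heM : e ∈ M := Ideal.mem_span_singleton_self e
  have hsimple : IsSimpleModule R M := by
    have : Nontrivial M := ⟨⟨e, heM⟩, 0, fun h => hne (congrArg Subtype.val h)⟩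
    refine { eq_bot_or_eq_top := fun I => ?_ }
    obtain ⟨J, hIJ⟩ := exists_isCompl I
    have hsup : (⟨e, heM⟩ : M) ∈ I ⊔ J := by rw [hIJ.sup_eq_top]; trivial
    obtain ⟨a, ha, b, hb, hab⟩ := Submodule.mem_sup.1 hsup
    have hab' : (a : R) + b = e := congrArg Subtype.val hab
    have hdisj : ∀ y : M, y ∈ I → y ∈ J → y = 0 := fun y h1 h2 =>
      (Submodule.mem_bot R).1 (hIJ.inf_eq_bot ▸ Submodule.mem_inf.2 ⟨h1, h2⟩)
    -- compare the two components of `a = a * e = a * a + a * b`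
    have h1 : (a : R) • b = 0 := by
      refine hdisj _ ?_ (J.smul_mem _ hb)
      have : (a : R) • b = a - (a : R) • a := by
        apply Subtype.ext
        change (a : R) * b = a - a * a
        rw [eq_sub_iff_add_eq, ← mul_add, add_comm (b : R), hab', hmem a a.2]
      rw [this]
      exact I.sub_mem ha (I.smul_mem _ ha)
    have h2 : (b : R) • a = 0 := by
      refine hdisj _ (I.smul_mem _ ha) ?_
      have : (b : R) • a = b - (b : R) • b := by
        apply Subtype.ext
        change (b : R) * a = b - b * b
        rw [eq_sub_iff_add_eq, ← mul_add, hab', hmem b b.2]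
      rw [this]
      exact J.sub_mem hb (J.smul_mem _ hb)
    have h1' : (a : R) * b = 0 := congrArg Subtype.val h1
    have h2' : (b : R) * a = 0 := congrArg Subtype.val h2
    have haa : IsIdempotentElem (a : R) := by
      have := hmem a a.2
      rw [← hab', mul_add, h1', add_zero] at this
      exact this
    have hbb : IsIdempotentElem (b : R) := by
      have := hmem b b.2
      rw [← hab', mul_add, h2', zero_add] at this
      exact this
    have hgen : ∀ (I : Submodule R M) (y : M), (y : R) = e → y ∈ I → I = ⊤ := by
      intro I y hy hyI
      rw [eq_top_iff]
      intro z _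
      have : z = (z : R) • y := by
        apply Subtype.ext
        change (z : R) = z * y
        rw [hy, hmem z z.2]
      rw [this]
      exact I.smul_mem _ hyI
    rcases hprim a b haa hbb h1' h2' hab'.symm with h0 | h0
    · left
      rw [h0, zero_add] at hab'
      have hJ := hgen J b hab' hb
      have := hIJ.inf_eq_bot
      rwa [hJ, inf_top_eq] at this
    · right
      rw [h0, add_zero] at hab'
      exact hgen I a hab' ha
  let φ : Module.End R M :=
    { toFun := fun y => ⟨y * (e * x * e), by
        rw [← mul_assoc]
        exact Ideal.mul_mem_left _ _ heM⟩
      map_add' := fun y z => Subtype.ext (add_mul _ _ _)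
      map_smul' := fun r y => Subtype.ext (mul_assoc _ _ _) }
  obtain ⟨c, hc⟩ := (IsSimpleModule.algebraMap_end_bijective_of_isAlgClosed (A := R) (V := M) k).2 φ
  refine ⟨c, ?_⟩
  have h1 := congrArg Subtype.val (LinearMap.congr_fun hc ⟨e, heM⟩)
  have h2 : c • e = e * (e * x * e) := h1
  rw [h2, ← mul_assoc, ← mul_assoc, hidem.eq]

end Corner

/-! ### Symmetric algebras and the Casimir operator -/

section SymmetricAlgebra
variable {R : Type*} [Ring R] [Algebra ℂ R] {n : ℕ}
  {τ : R →ₗ[ℂ] ℂ} {u v : Fin n → R}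

/-- The Casimir operator `p ↦ ∑ vᵢ p uᵢ` attached to dual bases `u`, `v` of `R`. -/
def casimir (u v : Fin n → R) (p : R) : R := ∑ i, v i * p * u i

section
variable (hτ : ∀ x y, τ (x * y) = τ (y * x)) (hdual : ∀ x, x = ∑ i, τ (x * v i) • u i)
include hdual

theorem eq_zero_of_forall_trace_mul_eq_zero {x : R} (h : ∀ y, τ (x * y) = 0) : x = 0 := by
  rw [hdual x]
  exact Finset.sum_eq_zero fun i _ => by rw [h, zero_smul]

include hτ

theorem eq_sum_dual (x : R) : x = ∑ i, τ (x * u i) • v i := by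
  rw [← sub_eq_zero]
  refine eq_zero_of_forall_trace_mul_eq_zero hdual fun y => ?_
  rw [sub_mul, map_sub, sub_eq_zero]
  conv_lhs => rw [hdual y]
  simp only [Finset.mul_sum, Finset.sum_mul, map_sum, mul_smul_comm, smul_mul_assoc, map_smul,
    smul_eq_mul]
  exact Finset.sum_congr rfl fun i _ => by rw [hτ y, mul_comm]

/-- The values of the Casimir operator are central. -/
theorem casimir_mul_comm (p y : R) : casimir u v p * y = y * casimir u v p := by
  have h1 : casimir u v p * y = ∑ i, ∑ j, τ (u i * y * v j) • (v i * p * u j) := by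
    rw [casimir, Finset.sum_mul]
    refine Finset.sum_congr rfl fun i _ => ?_
    rw [mul_assoc (v i * p)]
    conv_lhs => rw [hdual (u i * y), Finset.mul_sum]
    simp only [mul_smul_comm]
  have h2 : y * casimir u v p = ∑ j, ∑ i, τ (u i * y * v j) • (v i * p * u j) := by
    rw [casimir, Finset.mul_sum]
    refine Finset.sum_congr rfl fun j _ => ?_
    rw [← mul_assoc, ← mul_assoc]
    conv_lhs => rw [eq_sum_dual hτ hdual (y * v j), Finset.sum_mul, Finset.sum_mul]
    refine Finset.sum_congr rfl fun i _ => ?_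
    rw [smul_mul_assoc, smul_mul_assoc, hτ, ← mul_assoc]
  rw [h1, h2, Finset.sum_comm]

omit hτ
variable [FiniteDimensional ℂ R]

theorem trace_eq_sum (T : Module.End ℂ R) : LinearMap.trace ℂ R T = ∑ i, τ (T (u i) * v i) := by
  have h1 : T = ∑ i, (τ ∘ₗ LinearMap.mulRight ℂ (v i)).smulRight (T (u i)) := by
    ext x
    conv_lhs => rw [hdual x]
    simp [LinearMap.sum_apply]
  conv_lhs => rw [h1, map_sum]
  simp only [LinearMap.trace_smulRight]
  rfl

/-- The center is reduced: if `z` is central and nilpotent then so is `z y`, and `τ(z y) = 0` for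
all `y`. -/
theorem isSemisimpleRing_center_of_trace (hnil : ∀ x, IsNilpotent x → τ x = 0) :
    IsSemisimpleRing (Subalgebra.center ℂ R) := by
  have : IsArtinianRing (Subalgebra.center ℂ R) := IsArtinianRing.of_finite ℂ _
  have : IsReduced (Subalgebra.center ℂ R) := by
    refine ⟨fun z hz => Subtype.ext ?_⟩
    refine eq_zero_of_forall_trace_mul_eq_zero hdual fun y => hnil _ ?_
    have h1 : IsNilpotent (z : R) := hz.map (Subalgebra.center ℂ R).val
    exact Commute.isNilpotent_mul_right (Subalgebra.mem_center_iff.1 z.2 y).symm h1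
  exact IsArtinianRing.isSemisimpleRing_of_isReduced _

/-- A central primitive idempotent of `R` is a primitive idempotent of the center, where
`IsPrimitiveIdempotent.exists_corner_eq_smul` applies. -/
theorem IsCentralPrimitiveIdempotent.exists_mul_eq_smul (hnil : ∀ x, IsNilpotent x → τ x = 0)
    {F : R}
    (hF : IsCentralPrimitiveIdempotent F) {z : R} (hz : ∀ y, z * y = y * z) :
    ∃ c : ℂ, F * z = c • F := by
  have := isSemisimpleRing_center_of_trace hdual hnil
  obtain ⟨hidem, hcen, hne, hprim⟩ := hF
  let F' : Subalgebra.center ℂ R := ⟨F, hcen⟩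
  let z' : Subalgebra.center ℂ R := ⟨z, Subalgebra.mem_center_iff.2 fun y => (hz y).symm⟩
  have hF' : IsPrimitiveIdempotent F' := by
    refine ⟨Subtype.ext hidem, fun h => hne (congrArg Subtype.val h), fun a b ha hb hab _ hs => ?_⟩
    rcases hprim a b (congrArg Subtype.val ha) (congrArg Subtype.val hb) a.2 b.2
      (congrArg Subtype.val hab) (congrArg Subtype.val hs) with h | h
    · exact Or.inl (Subtype.ext h)
    · exact Or.inr (Subtype.ext h)
  obtain ⟨c, hc⟩ := hF'.exists_corner_eq_smul (k := ℂ) z'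
  refine ⟨c, ?_⟩
  have h1 : F * z * F = c • F := congrArg Subtype.val hc
  rwa [mul_assoc, hz F, ← mul_assoc, hidem.eq] at h1

include hτ

theorem trace_mulLeft_mulRight (p q : R) :
    LinearMap.trace ℂ R (LinearMap.mulLeft ℂ p ∘ₗ LinearMap.mulRight ℂ q) =
      τ (casimir u v p * q) := by
  rw [trace_eq_sum hdual, casimir, Finset.sum_mul, map_sum]
  refine Finset.sum_congr rfl fun i _ => ?_
  change τ (p * (u i * q) * v i) = _
  rw [hτ, ← mul_assoc, ← mul_assoc]

/-- An algebra with a symmetrizing trace that vanishes on nilpotent elements is semisimple. -/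
theorem isSemisimpleRing_of_trace (hnil : ∀ x, IsNilpotent x → τ x = 0) : IsSemisimpleRing R := by
  have : IsArtinianRing R := IsArtinianRing.of_finite ℂ R
  rw [IsArtinianRing.isSemisimpleRing_iff_jacobson, eq_bot_iff]
  intro x hx
  rw [Submodule.mem_bot]
  refine eq_zero_of_forall_trace_mul_eq_zero hdual fun y => ?_
  rw [hτ]
  refine hnil _ ?_
  have hxy : y * x ∈ Ring.jacobson R := Ideal.mul_mem_left _ _ hx
  obtain ⟨m, hm⟩ := IsSemiprimaryRing.isNilpotent (R := R)
  refine ⟨m, ?_⟩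
  have := Ideal.pow_mem_pow hxy m
  rw [hm] at this
  exact (Submodule.mem_bot R).1 this

/-- For a primitive idempotent `f` belonging to the central primitive idempotent `F`, the Casimir
element of `f` is a multiple `s F`. The traces of `x ↦ f x` and of `x ↦ f x f`, which are
`dim (f R)` and `1`, are `s τ(F)` and `s τ(f)`. -/
theorem dimRightIdeal_mul_trace (hnil : ∀ x, IsNilpotent x → τ x = 0) {F f : R}
    (hF : IsCentralPrimitiveIdempotent F) (hf : IsPrimitiveIdempotent f) (hFf : F * f = f) :
    τ f ≠ 0 ∧ (dimRightIdeal ℂ f : ℂ) * τ f = τ F := by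
  have := isSemisimpleRing_of_trace hτ hdual hnil
  have hFc : ∀ y, F * y = y * F := fun y => (Subring.mem_center_iff.1 hF.2.1 y).symm
  obtain ⟨s, hs⟩ := hF.exists_mul_eq_smul hdual hnil (casimir_mul_comm hτ hdual f)
  have hs' : casimir u v f = s • F := by
    rw [← hs, casimir, Finset.mul_sum]
    refine Finset.sum_congr rfl fun i _ => ?_
    rw [← mul_assoc, ← mul_assoc, hFc (v i), mul_assoc (v i) F, hFf]
  have h1 : (dimRightIdeal ℂ f : ℂ) = s * τ F := by
    have hidem : IsIdempotentElem (LinearMap.mulLeft ℂ f : Module.End ℂ R) :=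
      LinearMap.ext fun x => by
        change f * (f * x) = f * x
        rw [← mul_assoc, hf.1.eq]
    rw [dimRightIdeal, ← trace_eq_finrank_range hidem]
    have h2 := trace_mulLeft_mulRight hτ hdual f 1
    rw [LinearMap.mulRight_one, LinearMap.comp_id, mul_one, hs', map_smul] at h2
    exact h2
  have h2 : s * τ f = 1 := by
    have h3 := trace_mulLeft_mulRight hτ hdual f f
    rw [hs', smul_mul_assoc, hFf, map_smul, smul_eq_mul] at h3
    rw [← h3]
    set P : Module.End ℂ R := LinearMap.mulLeft ℂ f ∘ₗ LinearMap.mulRight ℂ f with hP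
    have hPx : ∀ x, P x = f * x * f := fun x => (mul_assoc f x f).symm
    have hidem : IsIdempotentElem P := LinearMap.ext fun x => by
      rw [Module.End.mul_apply, hPx, hPx, ← mul_assoc, ← mul_assoc, hf.1.eq, mul_assoc, hf.1.eq]
    have hrange : LinearMap.range P = Submodule.span ℂ {f} := by
      apply le_antisymm
      · rintro _ ⟨x, rfl⟩
        obtain ⟨c, hc⟩ := hf.exists_corner_eq_smul (k := ℂ) x
        rw [hPx, hc]
        exact Submodule.smul_mem _ _ (Submodule.mem_span_singleton_self _)
      · rw [Submodule.span_singleton_le_iff_mem]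
        exact ⟨1, by rw [hPx, mul_one, hf.1.eq]⟩
    rw [trace_eq_finrank_range hidem, hrange, finrank_span_singleton hf.2.1, Nat.cast_one]
  refine ⟨right_ne_zero_of_mul_eq_one h2, ?_⟩
  rw [h1, mul_right_comm, h2, one_mul]

end
end SymmetricAlgebra

/-! ### Central primitive idempotents -/

section CentralIdempotents
variable {R : Type*} [Ring R]

/-- The decomposition `F = F G + F (1 - G)` is trivial. -/
theorem IsCentralPrimitiveIdempotent.mul_eq_zero_or {F G : R} (hF : IsCentralPrimitiveIdempotent F)
    (hG : IsIdempotentElem G) (hGc : G ∈ Subring.center R) : F * G = 0 ∨ F * G = F := by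
  obtain ⟨hidem, hcen, hne, hprim⟩ := hF
  have hcomm : Commute F G := Subring.mem_center_iff.1 hGc F
  have h1 : IsIdempotentElem (F * G) := hidem.mul_of_commute hcomm hG
  have h2 : IsIdempotentElem (F * (1 - G)) :=
    hidem.mul_of_commute ((Commute.one_right F).sub_right hcomm) hG.one_sub
  have h3 : F * G * (F * (1 - G)) = 0 := by
    rw [mul_assoc, ← mul_assoc G, ← hcomm.eq, mul_assoc F, mul_sub, mul_one, hG.eq, sub_self,
      mul_zero, mul_zero]
  rcases hprim _ _ h1 h2 (mul_mem hcen hGc) (mul_mem hcen (sub_mem (one_mem _) hGc)) h3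
    (by rw [← mul_add, add_sub_cancel, mul_one]) with h | h
  · exact Or.inl h
  · right
    rw [mul_sub, mul_one, sub_eq_zero] at h
    exact h.symm

theorem IsCentralPrimitiveIdempotent.mul_eq_zero_of_ne {F G : R}
    (hF : IsCentralPrimitiveIdempotent F) (hG : IsCentralPrimitiveIdempotent G) (h : F ≠ G) :
    F * G = 0 := by
  rcases hF.mul_eq_zero_or hG.1 hG.2.1 with h1 | h1
  · exact h1
  · rcases hG.mul_eq_zero_or hF.1 hF.2.1 with h2 | h2
    · rw [← Subring.mem_center_iff.1 hF.2.1 G]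
      exact h2
    · exact absurd (by rw [← h1, Subring.mem_center_iff.1 hG.2.1 F, h2]) h

end CentralIdempotents

/-! ### The trace on the character algebra -/

section CharacterAlgebra
variable {H : Type u} [Ring H] [HopfAlgebra ℂ H] [IsSemisimpleRing H]

/-- Evaluation at `Λ`, as a linear functional on the character algebra. -/
noncomputable def integralTrace (Λ : H) : characterAlgebra ℂ H →ₗ[ℂ] ℂ :=
  evalAt Λ ∘ₗ (characterAlgebra ℂ H).val.toLinearMap

variable [FiniteDimensional ℂ H] {Λ : H} (hΛ : IsNormalizedIntegral ℂ Λ)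
include hΛ

/-- Evaluation at the integral is symmetric, as `dim H` times it is the trace of the regular
representation of `H^*`. -/
theorem integral_mul_comm (p q : Dual ℂ H) : (p * q) Λ = (q * p) Λ := by
  refine mul_left_cancel₀ (finrank_ne_zero_of_integral hΛ) ?_
  rw [← trace_mulLeft_dual hΛ, ← trace_mulLeft_dual hΛ, LinearMap.mulLeft_mul,
    LinearMap.mulLeft_mul]
  exact LinearMap.trace_mul_comm ℂ (LinearMap.mulLeft ℂ p) (LinearMap.mulLeft ℂ q)

theorem integralTrace_mul_comm (x y : characterAlgebra ℂ H) :
    integralTrace Λ (x * y) = integralTrace Λ (y * x) :=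
  integral_mul_comm hΛ _ _

theorem integralTrace_eq_zero_of_isNilpotent (x : characterAlgebra ℂ H) (hx : IsNilpotent x) :
    integralTrace Λ x = 0 :=
  integral_eq_zero_of_isNilpotent hΛ (hx.map (characterAlgebra ℂ H).val)

variable {n : ℕ} (χ : Fin n ≃ {χ : Dual ℂ H // IsIrreducibleCharacter ℂ H χ})

include χ in
/-- The identity `τ(F) = dim (f R(H)) τ(f)` for the trace `τ(p) = p(Λ)`, for which the irreducible
characters and their composites with the antipode are dual bases. -/
theorem dimRightIdeal_mul_integral {F f : characterAlgebra ℂ H}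
    (hF : IsCentralPrimitiveIdempotent F) (hf : IsPrimitiveIdempotent f) (hFf : F * f = f) :
    (f : Dual ℂ H) Λ ≠ 0 ∧
      (dimRightIdeal ℂ f : ℂ) * (f : Dual ℂ H) Λ = (F : Dual ℂ H) Λ := by
  refine dimRightIdeal_mul_trace (τ := integralTrace Λ)
    (u := fun i => ⟨(χ i).1, Submodule.subset_span (χ i).2⟩)
    (v := fun i => ⟨antipodeDual (χ i).1, (χ i).2.isTraceCharacter.comp_antipode.mem_characterSpan⟩)
    (integralTrace_mul_comm hΛ) (fun x => Subtype.ext ?_)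
    (integralTrace_eq_zero_of_isNilpotent hΛ) hF hf hFf
  conv_lhs => rw [eq_sum_characters χ hΛ x.2]
  rw [AddSubmonoidClass.coe_finsetSum]
  rfl

/-- The central primitive idempotents are fixed by the positive involution `†`: as `F F† ≠ 0`,
the central idempotent `F†` satisfies `F F† = F`, and the left-hand side is self-adjoint. -/
theorem IsCentralPrimitiveIdempotent.dagger_eq {F : characterAlgebra ℂ H}
    (hF : IsCentralPrimitiveIdempotent F) : dagger χ Λ (F : Dual ℂ H) = F := by
  let G : characterAlgebra ℂ H := ⟨dagger χ Λ F, dagger_mem χ _⟩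
  have hidem : (F : Dual ℂ H) * F = F := congrArg Subtype.val hF.1
  have hG : IsIdempotentElem G := Subtype.ext (by
    change dagger χ Λ F * dagger χ Λ F = dagger χ Λ F
    rw [← dagger_mul χ hΛ F.2 F.2, hidem])
  have hGc : G ∈ Subring.center (characterAlgebra ℂ H) := by
    refine Subring.mem_center_iff.2 fun x => Subtype.ext ?_
    change (x : Dual ℂ H) * dagger χ Λ F = dagger χ Λ F * x
    have h1 : dagger χ Λ (x : Dual ℂ H) * (F : Dual ℂ H) = F * dagger χ Λ (x : Dual ℂ H) :=
      congrArg Subtype.val (Subring.mem_center_iff.1 hF.2.1 ⟨dagger χ Λ x, dagger_mem χ _⟩)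
    have h2 := congrArg (dagger χ Λ) h1
    rw [dagger_mul χ hΛ (dagger_mem χ _) F.2, dagger_mul χ hΛ F.2 (dagger_mem χ _),
      dagger_dagger χ hΛ x.2] at h2
    exact h2.symm
  rcases hF.mul_eq_zero_or hG hGc with h | h
  · refine absurd (Subtype.ext (eq_zero_of_integral_mul_dagger χ hΛ F.2 ?_)) hF.2.2.1
    have h1 : (F : Dual ℂ H) * dagger χ Λ F = 0 := congrArg Subtype.val h
    rw [h1]
    rfl
  · have h1 : (F : Dual ℂ H) * dagger χ Λ F = F := congrArg Subtype.val h
    have h2 := congrArg (dagger χ Λ) h1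
    rw [dagger_mul χ hΛ F.2 (dagger_mem χ _), dagger_dagger χ hΛ F.2, h1] at h2
    exact h2.symm

/-- As `F = F†` is the combination of the `χᵢ ∘ S` with coefficients `conj τ(F (χᵢ ∘ S))`,
orthonormality gives `τ(F χₖ) = conj τ(F (χₖ ∘ S))`. -/
theorem IsCentralPrimitiveIdempotent.conj_integral_mul {F : characterAlgebra ℂ H}
    (hF : IsCentralPrimitiveIdempotent F) (k : Fin n) :
    (starRingEnd ℂ) (((F : Dual ℂ H) * (χ k).1) Λ) =
      ((F : Dual ℂ H) * antipodeDual (χ k).1) Λ := by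
  conv_lhs => rw [← hF.dagger_eq hΛ χ, dagger, Finset.sum_mul, dual_sum_apply]
  have h1 : ∀ i, (((starRingEnd ℂ) (((F : Dual ℂ H) * antipodeDual (χ i).1) Λ) •
      antipodeDual (χ i).1) * (χ k).1) Λ = (starRingEnd ℂ)
        (((F : Dual ℂ H) * antipodeDual (χ i).1) Λ) * if k = i then 1 else 0 := by
    intro i
    rw [smul_mul_assoc, dual_smul_apply, integral_mul_comm hΛ (antipodeDual _),
      integral_mul_antipodeDual χ hΛ]
  simp only [h1, mul_ite, mul_one, mul_zero]
  rw [Finset.sum_ite_eq, if_pos (Finset.mem_univ k), Complex.conj_conj]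

/-- Parseval's identity for the orthonormal basis of irreducible characters. -/
theorem sum_integral_mul_conj {F G : characterAlgebra ℂ H} (hG : IsCentralPrimitiveIdempotent G) :
    ∑ k, ((F : Dual ℂ H) * (χ k).1) Λ * (starRingEnd ℂ) (((G : Dual ℂ H) * (χ k).1) Λ) =
      ((F : Dual ℂ H) * G) Λ := by
  conv_rhs => rw [eq_sum_characters χ hΛ G.2, Finset.mul_sum, dual_sum_apply]
  refine Finset.sum_congr rfl fun k _ => ?_
  rw [hG.conj_integral_mul hΛ χ, mul_smul_comm, dual_smul_apply, mul_comm]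

end CharacterAlgebra

/-! ### The generalized character table -/

section Table
variable {H : Type u} [Ring H] [HopfAlgebra ℂ H] [IsSemisimpleRing H]

theorem characterTable_apply (Λ : H) {n m : ℕ} (χ : Fin n → Dual ℂ H)
    (F f : Fin m → characterAlgebra ℂ H) (k : Fin n) (j : Fin m) :
    characterTable Λ χ F f k j = (Module.finrank ℂ H : ℂ) /
      (dimRightIdeal ℂ (f j : Dual ℂ H) : ℂ) * ((F j : Dual ℂ H) * χ k) Λ := by
  rw [characterTable, normalizedClassSum, classSum, dual_map_smul, apply_rightHit, smul_mul_assoc,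
    dual_smul_apply]
  ring

end Table

end HopfCharacterTable

theorem mainTheorem6 {H : Type*} [Ring H] [HopfAlgebra ℂ H] [FiniteDimensional ℂ H]
    [IsSemisimpleRing H]
    (Λ : H) (hΛ : HopfCharacterTable.IsNormalizedIntegral ℂ Λ)
    {n m : ℕ}
    (χ : Fin n ≃ {χ : HopfCharacterTable.Dual ℂ H //
      HopfCharacterTable.IsIrreducibleCharacter ℂ H χ})
    (F : Fin m ≃ {F : HopfCharacterTable.characterAlgebra ℂ H //
      HopfCharacterTable.IsCentralPrimitiveIdempotent F})
    (f : Fin m → HopfCharacterTable.characterAlgebra ℂ H)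
    (hf : ∀ j, HopfCharacterTable.IsPrimitiveIdempotent (f j))
    (hfF : ∀ j, (F j : HopfCharacterTable.characterAlgebra ℂ H) * f j = f j)
    (ξ : Fin n → Fin m → ℂ)
    (hξ : ξ = HopfCharacterTable.characterTable Λ (fun k => (χ k).1) (fun j => (F j).1) f)
    (i j : Fin m) :
    ∑ k, ξ k i * (starRingEnd ℂ) (ξ k j) =
      if i = j then
        (Module.finrank ℂ H : ℂ) * (HopfCharacterTable.dimRightIdeal ℂ (f i) : ℂ) /
          (HopfCharacterTable.dimRightIdeal ℂ (f i : HopfCharacterTable.Dual ℂ H) : ℂ)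
      else 0 := by
  open HopfCharacterTable in
  set d : ℂ := (Module.finrank ℂ H : ℂ) with hd
  have hconj : ∀ j, (starRingEnd ℂ) (d / (dimRightIdeal ℂ (f j : Dual ℂ H) : ℂ)) =
      d / (dimRightIdeal ℂ (f j : Dual ℂ H) : ℂ) := fun j => by
    rw [map_div₀, hd, map_natCast, map_natCast]
  have hsum : ∑ k, ξ k i * (starRingEnd ℂ) (ξ k j) =
      d / (dimRightIdeal ℂ (f i : Dual ℂ H) : ℂ) * (d / (dimRightIdeal ℂ (f j : Dual ℂ H) : ℂ)) *
        (((F i).1 : Dual ℂ H) * ((F j).1 : Dual ℂ H)) Λ := by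
    rw [← sum_integral_mul_conj hΛ χ (F j).2, Finset.mul_sum]
    refine Finset.sum_congr rfl fun k _ => ?_
    rw [hξ, characterTable_apply, characterTable_apply, map_mul, hconj]
    ring
  rw [hsum]
  split_ifs with h
  · subst h
    obtain ⟨h0, h1⟩ := dimRightIdeal_mul_integral hΛ χ (F i).2 (hf i) (hfF i)
    have h2 : (dimRightIdeal ℂ (f i : Dual ℂ H) : ℂ) = d * (f i : Dual ℂ H) Λ :=
      dimRightIdeal_dual hΛ (congrArg Subtype.val (hf i).1)
    have h3 : ((F i).1 : Dual ℂ H) * ((F i).1 : Dual ℂ H) = ((F i).1 : Dual ℂ H) :=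
      congrArg Subtype.val (F i).2.1
    have hd0 : d ≠ 0 := finrank_ne_zero_of_integral hΛ
    rw [h3, ← h1, h2]
    field_simp
  · have h3 : ((F i).1 : Dual ℂ H) * ((F j).1 : Dual ℂ H) = 0 := congrArg Subtype.val
      ((F i).2.mul_eq_zero_of_ne (F j).2 fun h1 => h (F.injective (Subtype.ext h1)))
    rw [h3]
    exact mul_zero _
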